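/- Let $(F_n)_{n\ge 1}$ be the Fibonacci numbers, $F_1=F_2=1$, $F_{n+2}=F_{n+1}+F_n$, and let $\alpha=(1+\sqrt5)/2$. For every periodic sequence $\mathbf{s}=(s_n)_{n\ge 1}$ in $\{-1,+1\}$ there exists an effectively computable rational number $C_{\mathbf{s}}>0$ such that $$\log \operatorname{lcm}(F_3+s_3,\,F_4+s_4,\,\dots,\,F_n+s_n)\;\sim\;\frac{3\log\alpha}{\pi^2}\cdot C_{\mathbf{s}}\cdot n^2\qquad\text{as } n\to+\infty .$$ Here $\mathbf{s}$ is periodic if there is an integer $T\ge 1$ with $s_{n+T}=s_n$ for all $n\ge 1$, and effective computability means that there is one algorithm which, for every such $\mathbf{s}$ and every such $T$, given the finite word $(s_1,\dots,s_T)$ as input, outputs the numerator and the denominator of a fraction equal to $C_{\mathbf{s}}$. -/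

import Mathlib

open Filter Asymptotics

/-- A rational-valued function `C` is effectively computable if a (total) recursive procedure
produces, for every input, the numerator and the (nonzero) denominator of a fraction that is
equal to the value of `C`. -/
def EffectivelyComputable {α : Type*} [Primcodable α] (C : α → ℚ) : Prop :=
  ∃ (num : α → ℤ) (den : α → ℕ), Computable num ∧ Computable den ∧
    ∀ a, den a ≠ 0 ∧ C a = (num a : ℚ) / (den a : ℚ)

/-- The word `s 1, s 2, …, s T`, for a sequence `s` indexed by the positive integers
(the value `s 0` plays no role). -/
def initialWord (s : ℕ → ℤ) (T : ℕ) : List ℤ :=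
  (List.range T).map fun i => s (i + 1)

/-- The least common multiple of `F_3 + s_3, F_4 + s_4, …, F_n + s_n`. -/
def shiftedFibLcm (s : ℕ → ℤ) (n : ℕ) : ℤ :=
  (Finset.Icc 3 n).lcm fun k => (Nat.fib k : ℤ) + s k

/-!
The factorizations `F_{2m+ε} + (-1)^m F_ε = F_{m+ε} L_m`, for `ε ∈ {±1, ±2}`, write every term
`F_k + s_k` with `k ≥ 3` as a Fibonacci number times a Lucas number whose indices are close to
`k / 2`. The two factors have no common prime `p ≥ 5`. Let the rank of apparition `fibRank q` of
`q` be the least `d > 0` with `q ∣ F_d`, so that `q ∣ F_n` if and only if `fibRank q ∣ n`. Since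
`F_{2m} = F_m L_m`, a prime power `q` of a prime `p ≥ 5` divides `L_m` if and only if its rank
divides `2m` but not `m`. Hence `q ∣ F_k + s_k` is a condition on `d = fibRank q`: some multiple
`j d` is even and lies at distance `1` or `2` from `k`, and `s_k` is a sign determined by `j` and
`j d / 2` (`prime_pow_dvd_fib_add_iff`).

The logarithm of the least common multiple is the sum of the von Mangoldt function over the prime
powers that divide one of the terms. Powers of `2` and `3` contribute `O(n)`. The prime powers of
rank `d` contribute `logPrimitivePart d`, which by Möbius inversion of `log F_m = m log α + O(1)` is
`φ(d) log α` up to a multiple of the number of divisors of `d`. So the logarithm is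
`log α * ∑ φ(d) + o(n ^ 2)`, where `d` runs through the ranks `accountedSet s n` that satisfy the
condition for some `k ≤ n` (`tendsto_log_lcm_sub_sum_totient`).

For a sign sequence with period `T` the condition on `j` and `d` depends on both modulo `4 T` only.
If `x` is the least admissible `j` for the residue class of `d`, then `d ∈ accountedSet s n` means
`d x ≤ n`, up to a bounded error, so the asymptotics of `∑ φ(d)` over `d ≤ y` in a residue class are
what is needed. They follow from the convolution `φ = μ * id`, restricted to divisors coprime to the
modulus (`tendsto_sum_totient_mod`). The unknown common constant is eliminated by comparison with
the sum over all `d ≤ y`, which is asymptotic to `3 / π ^ 2 * y ^ 2`. The resulting constant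
`wordConstant` is a weighted mean of the numbers `1 / x ^ 2` with rational weights. All its
ingredients are bounded sums and searches, hence primitive recursive.
-/

/-! ### Fibonacci and Lucas numbers, rank of apparition -/

/-- The Lucas number `L_n = F_{n-1} + F_{n+1}`, written as `2 F_{n+1} - F_n`. -/
def lucasNumber (n : ℕ) : ℤ := 2 * (Nat.fib (n + 1) : ℤ) - Nat.fib n

/-- The Fibonacci number `F_ε` for `ε = e - 2 ∈ {-2, -1, 1, 2}`. -/
def fibOffset (e : ℕ) : ℤ := if e = 0 then -1 else 1

theorem fib_cassini (n : ℕ) :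
    (Nat.fib (n + 1) : ℤ) ^ 2 - Nat.fib (n + 1) * Nat.fib n - (Nat.fib n : ℤ) ^ 2 = (-1) ^ n := by
  induction n with
  | zero => simp
  | succ n ih =>
    rw [Nat.fib_add_two, pow_succ (-1 : ℤ), ← ih]
    push_cast
    ring

theorem fib_two_mul_eq_mul_lucasNumber (n : ℕ) :
    (Nat.fib (2 * n) : ℤ) = Nat.fib n * lucasNumber n := by
  have h : Nat.fib n ≤ 2 * Nat.fib (n + 1) :=
    (Nat.fib_le_fib_succ).trans (Nat.le_mul_of_pos_left _ two_pos)
  rw [Nat.fib_two_mul, lucasNumber]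
  push_cast [h]
  ring

/-- The identity `F_{2m+ε} + (-1)^m F_ε = F_{m+ε} L_m` for `ε = e - 2 ∈ {±1, ±2}`. -/
theorem fib_add_sign_eq_mul {m k b e : ℕ} (he : e = 0 ∨ e = 1 ∨ e = 3 ∨ e = 4)
    (hk : k + 2 = 2 * m + e) (hb : b + 2 = m + e) :
    (Nat.fib k : ℤ) + (-1) ^ m * fibOffset e = Nat.fib b * lucasNumber m := by
  rcases he with rfl | rfl | rfl | rfl
  · obtain rfl : m = b + 2 := by omega
    obtain rfl : k = 2 * b + 2 := by omega
    have h := fib_cassini b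
    rw [pow_add, ← h, Nat.fib_add_two (n := 2 * b), Nat.fib_two_mul_add_one]
    push_cast
    rw [fib_two_mul_eq_mul_lucasNumber]
    simp only [fibOffset, lucasNumber, Nat.fib_add_two]
    push_cast [Nat.fib_add_two]
    norm_num
    ring
  · obtain rfl : m = b + 1 := by omega
    obtain rfl : k = 2 * b + 1 := by omega
    have h := fib_cassini b
    rw [pow_add, ← h, Nat.fib_two_mul_add_one]
    simp only [fibOffset, lucasNumber, Nat.fib_add_two]
    push_cast
    norm_num
    ring
  · obtain rfl : b = m + 1 := by omega
    obtain rfl : k = 2 * m + 1 := by omega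
    rw [← fib_cassini m, Nat.fib_two_mul_add_one]
    simp only [fibOffset, lucasNumber]
    push_cast
    norm_num
    ring
  · obtain rfl : b = m + 2 := by omega
    obtain rfl : k = 2 * m + 2 := by omega
    rw [← fib_cassini m, Nat.fib_add_two (n := 2 * m), Nat.fib_two_mul_add_one]
    push_cast
    rw [fib_two_mul_eq_mul_lucasNumber]
    simp only [fibOffset, lucasNumber, Nat.fib_add_two]
    push_cast
    norm_num
    ring

/-- Every pair of an index `k ≥ 3` and a sign arises in `fib_add_sign_eq_mul`. -/
theorem exists_half_index {k : ℕ} (hk : 3 ≤ k) {s : ℤ} (hs : s = -1 ∨ s = 1) :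
    ∃ m e, (e = 0 ∨ e = 1 ∨ e = 3 ∨ e = 4) ∧ k + 2 = 2 * m + e ∧ s = (-1) ^ m * fibOffset e := by
  obtain ⟨h, i, hi, rfl⟩ : ∃ h i, i < 4 ∧ k = 4 * h + i :=
    ⟨k / 4, k % 4, Nat.mod_lt _ (by norm_num), by omega⟩
  have key : ∀ c m e : ℕ, (e = 0 ∨ e = 1 ∨ e = 3 ∨ e = 4) → 4 * h + i + 2 = 2 * m + e →
      (m + c) % 2 = 0 → s = (-1) ^ c * fibOffset e →
      ∃ m e, (e = 0 ∨ e = 1 ∨ e = 3 ∨ e = 4) ∧ 4 * h + i + 2 = 2 * m + e ∧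
        s = (-1) ^ m * fibOffset e := by
    intro c m e he hm hc hs
    refine ⟨m, e, he, hm, ?_⟩
    rw [hs, neg_one_pow_eq_pow_mod_two, neg_one_pow_eq_pow_mod_two (n := m),
      show c % 2 = m % 2 by omega]
  rcases hs with rfl | rfl <;> interval_cases i
  · exact key 1 (2 * h - 1) 4 (by simp) (by omega) (by omega) (by simp [fibOffset])
  · exact key 1 (2 * h + 1) 1 (by simp) (by omega) (by omega) (by simp [fibOffset])
  · exact key 0 (2 * h + 2) 0 (by simp) (by omega) (by omega) (by simp [fibOffset])
  · exact key 1 (2 * h + 1) 3 (by simp) (by omega) (by omega) (by simp [fibOffset])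
  · exact key 1 (2 * h + 1) 0 (by simp) (by omega) (by omega) (by simp [fibOffset])
  · exact key 0 (2 * h) 3 (by simp) (by omega) (by omega) (by simp [fibOffset])
  · exact key 0 (2 * h) 4 (by simp) (by omega) (by omega) (by simp [fibOffset])
  · exact key 0 (2 * h + 2) 1 (by simp) (by omega) (by omega) (by simp [fibOffset])

/-- The rank of apparition of `q` in the Fibonacci sequence: the least `n > 0` with `q ∣ F_n`
(and `0` if there is none, so that `dvd_fib_iff` needs no existence statement). -/
noncomputable def fibRank (q : ℕ) : ℕ := sInf {n | 0 < n ∧ q ∣ Nat.fib n}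

theorem dvd_fib_iff {q n : ℕ} : q ∣ Nat.fib n ↔ fibRank q ∣ n := by
  rcases Set.eq_empty_or_nonempty {n | 0 < n ∧ q ∣ Nat.fib n} with h | h
  · rw [fibRank, h, Nat.sInf_empty, zero_dvd_iff]
    constructor
    · intro hn
      by_contra h0
      exact (h ▸ (⟨Nat.pos_of_ne_zero h0, hn⟩ : n ∈ {n | 0 < n ∧ q ∣ Nat.fib n}) :
        n ∈ (∅ : Set ℕ))
    · rintro rfl
      simp
  · have hr : 0 < fibRank q ∧ q ∣ Nat.fib (fibRank q) := Nat.sInf_mem h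
    refine ⟨fun hn => ?_, fun hn => hr.2.trans (Nat.fib_dvd _ _ hn)⟩
    have hg : q ∣ Nat.fib ((fibRank q).gcd n) := by
      rw [Nat.fib_gcd]
      exact Nat.dvd_gcd hr.2 hn
    have hle : fibRank q ≤ (fibRank q).gcd n :=
      Nat.sInf_le ⟨Nat.gcd_pos_of_pos_left _ hr.1, hg⟩
    exact (Nat.le_antisymm (Nat.gcd_le_left _ hr.1) hle) ▸ Nat.gcd_dvd_right (fibRank q) n

/-- `F_n` and `L_n` have no common prime factor other than `2`. -/
theorem not_dvd_fib_and_lucasNumber {p n : ℕ} (hp : p.Prime) (h2 : p ≠ 2)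
    (hf : p ∣ Nat.fib n) : ¬ (p : ℤ) ∣ lucasNumber n := by
  intro hl
  have h1 : (p : ℤ) ∣ 2 * (Nat.fib (n + 1) : ℤ) := by
    have := dvd_add hl (Int.natCast_dvd_natCast.2 hf)
    simpa [lucasNumber] using this
  have h3 : p ∣ 2 * Nat.fib (n + 1) := by exact_mod_cast h1
  rcases (Nat.Prime.dvd_mul hp).1 h3 with h | h
  · exact h2 ((Nat.prime_dvd_prime_iff_eq hp Nat.prime_two).1 h)
  · exact hp.one_lt.ne' (Nat.eq_one_of_dvd_coprimes (Nat.fib_coprime_fib_succ n) hf h)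

theorem prime_pow_dvd_lucasNumber_iff {p i n : ℕ} (hp : p.Prime) (h2 : p ≠ 2) (hi : i ≠ 0) :
    ((p ^ i : ℕ) : ℤ) ∣ lucasNumber n ↔ fibRank (p ^ i) ∣ 2 * n ∧ ¬ fibRank (p ^ i) ∣ n := by
  have hp' : Prime (p : ℤ) := Nat.prime_iff_prime_int.1 hp
  rw [← dvd_fib_iff, ← dvd_fib_iff]
  constructor
  · intro h
    refine ⟨?_, fun hf => ?_⟩
    · rw [← Int.natCast_dvd_natCast, fib_two_mul_eq_mul_lucasNumber]
      exact h.mul_left _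
    · have hpq : p ∣ p ^ i := dvd_pow_self p hi
      exact not_dvd_fib_and_lucasNumber hp h2 (hpq.trans hf)
        ((Int.natCast_dvd_natCast.2 hpq).trans h)
  · rintro ⟨h, hn⟩
    rw [← Int.natCast_dvd_natCast, fib_two_mul_eq_mul_lucasNumber] at h
    rw [← Int.natCast_dvd_natCast] at hn
    push_cast at h hn ⊢
    have hl : ¬ (p : ℤ) ∣ lucasNumber n → False := fun hl =>
      hn (hp'.pow_dvd_of_dvd_mul_right i hl h)
    have hf : ¬ (p : ℤ) ∣ (Nat.fib n : ℤ) := fun hf =>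
      hl (not_dvd_fib_and_lucasNumber hp h2 (by exact_mod_cast hf))
    exact hp'.pow_dvd_of_dvd_mul_left i hf h

/-- `F_b` and `L_m` with `|b - m| ≤ 2` have no common prime factor other than `2` and `3`. -/
theorem not_dvd_fib_and_lucasNumber_of_near {p m b e : ℕ} (hp5 : 5 ≤ p)
    (he : e = 0 ∨ e = 1 ∨ e = 3 ∨ e = 4) (hb : b + 2 = m + e)
    (hf : p ∣ Nat.fib b) : ¬ (p : ℤ) ∣ lucasNumber m := by
  intro hl
  have h2m : p ∣ Nat.fib (2 * m) := by
    rw [← Int.natCast_dvd_natCast, fib_two_mul_eq_mul_lucasNumber]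
    exact hl.mul_left _
  have hr1 : (fibRank p : ℤ) ∣ b := Int.natCast_dvd_natCast.2 (dvd_fib_iff.1 hf)
  have hr2 : (fibRank p : ℤ) ∣ (2 * m : ℕ) := Int.natCast_dvd_natCast.2 (dvd_fib_iff.1 h2m)
  have hr3 : (fibRank p : ℤ) ∣ 4 := by
    have h := dvd_sub (hr1.mul_left 2) hr2
    have hb' : (b : ℤ) = m + e - 2 := by omega
    rw [hb'] at h
    push_cast at h
    rcases he with rfl | rfl | rfl | rfl <;> push_cast at h <;> ring_nf at h
    · exact (dvd_neg.2 h).trans (by norm_num)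
    · exact h.trans (by norm_num)
    · exact h.trans (by norm_num)
    · exact h
  have h4 : p ∣ Nat.fib 4 := dvd_fib_iff.2 (by exact_mod_cast hr3)
  have := Nat.le_of_dvd (by decide) h4
  have h43 : Nat.fib 4 = 3 := by decide
  omega

/-- The multiple `j * d` of `d` accounts for the term of index `k` and sign `s`. Here
`j * d = 2 * m`, and the term is `F_{2m+ε} + s` with `ε = e - 2`. For even `j` (that is `d ∣ m`)
the sign is the one for which the term equals `F_m L_{m+ε}`, for odd `j` the one for which it
equals `F_{m+ε} L_m`. -/
def Accounts (s : ℤ) (d j e k : ℕ) : Prop :=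
  (e = 0 ∨ e = 1 ∨ e = 3 ∨ e = 4) ∧ 2 ∣ j * d ∧ k + 2 = j * d + e ∧
    s = -(-1) ^ (j + j * d / 2) * fibOffset e

/-- A prime power `p ^ i` with `p ≥ 5` divides `F_k + s` if and only if a multiple of its rank of
apparition accounts for this term. -/
theorem prime_pow_dvd_fib_add_iff {p i k : ℕ} {s : ℤ} (hp : p.Prime) (hp5 : 5 ≤ p) (hi : i ≠ 0)
    (hk : 3 ≤ k) (hs : s = -1 ∨ s = 1) :
    ((p ^ i : ℕ) : ℤ) ∣ (Nat.fib k : ℤ) + s ↔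
      ∃ j e, 0 < j ∧ Accounts s (fibRank (p ^ i)) j e k := by
  have hp' : Prime (p : ℤ) := Nat.prime_iff_prime_int.1 hp
  have hp2 : p ≠ 2 := by omega
  constructor
  · obtain ⟨m, e, he, hm, rfl⟩ := exists_half_index hk hs
    obtain ⟨b, hb⟩ : ∃ b, b + 2 = m + e := ⟨m + e - 2, by omega⟩
    rw [fib_add_sign_eq_mul he hm hb]
    intro h
    by_cases hf : p ∣ Nat.fib b
    · have hl := not_dvd_fib_and_lucasNumber_of_near hp5 he hb hf
      push_cast at h
      have h' := hp'.pow_dvd_of_dvd_mul_right i hl h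
      have h'' : fibRank (p ^ i) ∣ b := dvd_fib_iff.1 (by exact_mod_cast h')
      obtain ⟨c, hc⟩ := h''
      have hjd : 2 * c * fibRank (p ^ i) = 2 * b := by rw [hc]; ring
      refine ⟨2 * c, 4 - e, ?_, by omega, ⟨b, by rw [hjd]⟩, by omega, ?_⟩
      · rcases Nat.eq_zero_or_pos c with rfl | h0
        · rw [mul_zero] at hc
          omega
        · omega
      · rw [hjd, Nat.mul_div_cancel_left _ two_pos, pow_add, pow_mul]
        have hpar : ((-1 : ℤ)) ^ m = (-1) ^ b * (-1) ^ e := by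
          rw [← pow_add, neg_one_pow_eq_pow_mod_two, neg_one_pow_eq_pow_mod_two (n := b + e),
            show m % 2 = (b + e) % 2 by omega]
        rw [hpar]
        rcases he with rfl | rfl | rfl | rfl <;> simp [fibOffset]
    · have hf' : ¬ (p : ℤ) ∣ (Nat.fib b : ℤ) := by exact_mod_cast hf
      push_cast at h
      have h' := hp'.pow_dvd_of_dvd_mul_left i hf' h
      rw [← Nat.cast_pow, prime_pow_dvd_lucasNumber_iff hp hp2 hi] at h'
      obtain ⟨⟨j, hj⟩, hn⟩ := h'
      have hodd : Odd j := by
        by_contra hev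
        rw [Nat.not_odd_iff_even] at hev
        obtain ⟨c, rfl⟩ := hev
        refine hn ⟨c, ?_⟩
        have : 2 * m = 2 * (fibRank (p ^ i) * c) := by rw [hj]; ring
        omega
      have hjd : j * fibRank (p ^ i) = 2 * m := by rw [hj]; ring
      refine ⟨j, e, hodd.pos, he, ⟨m, hjd⟩, by omega, ?_⟩
      rw [hjd, Nat.mul_div_cancel_left _ two_pos, pow_add, hodd.neg_one_pow]
      ring
  · rintro ⟨j, e, hj, he, ⟨m, hm⟩, hk', hs'⟩
    rw [hm, Nat.mul_div_cancel_left _ two_pos] at hs'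
    rw [hm] at hk'
    obtain ⟨b, hb⟩ : ∃ b, b + 2 = m + e := ⟨m + e - 2, by omega⟩
    rcases Nat.even_or_odd j with hev | hodd
    · obtain ⟨c, rfl⟩ := hev
      have hdm : fibRank (p ^ i) ∣ m := ⟨c, by
        have : 2 * m = 2 * (fibRank (p ^ i) * c) := by rw [← hm]; ring
        omega⟩
      have hs2 : s = (-1) ^ b * fibOffset (4 - e) := by
        have hpar : ((-1 : ℤ)) ^ m = (-1) ^ b * (-1) ^ e := by
          rw [← pow_add, neg_one_pow_eq_pow_mod_two, neg_one_pow_eq_pow_mod_two (n := b + e),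
            show m % 2 = (b + e) % 2 by omega]
        rw [hs', pow_add, hpar, ← two_mul, pow_mul]
        rcases he with rfl | rfl | rfl | rfl <;> simp [fibOffset]
      rw [hs2, fib_add_sign_eq_mul (m := b) (b := m) (by omega) (by omega) (by omega)]
      exact (Int.natCast_dvd_natCast.2 (dvd_fib_iff.2 hdm)).mul_right _
    · have hs2 : s = (-1) ^ m * fibOffset e := by
        rw [hs', pow_add, hodd.neg_one_pow]
        ring
      rw [hs2, fib_add_sign_eq_mul he (by omega) hb]
      refine Dvd.dvd.mul_left ((prime_pow_dvd_lucasNumber_iff hp hp2 hi).2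
        ⟨⟨j, by rw [← hm]; ring⟩, ?_⟩) _
      rintro ⟨c, hc⟩
      have hpos : 0 < fibRank (p ^ i) := by
        rcases Nat.eq_zero_or_pos (fibRank (p ^ i)) with h0 | h0
        · rw [h0, zero_mul] at hc
          omega
        · exact h0
      have h2c : j = 2 * c := by
        refine Nat.eq_of_mul_eq_mul_right hpos ?_
        rw [hm, hc]
        ring
      rw [h2c] at hodd
      exact (Nat.not_odd_iff_even.2 (even_two_mul c)) hodd

/-! ### Euler's function in residue classes -/

/-- A periodic weight `u` contributes its mean value to `∑_{f ≤ y} u(f) f`. -/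
theorem tendsto_sum_periodic_mul_self {u : ℕ → ℝ} {M : ℕ} (hM : 0 < M)
    (hu : ∀ n, u (n + M) = u n) :
    Tendsto (fun y : ℕ => (∑ f ∈ Finset.Ioc 0 y, u f * f) / (y : ℝ) ^ 2) atTop
      (nhds ((∑ f ∈ Finset.range M, u f) / M / 2)) := by
  have hM0 : (M : ℝ) ≠ 0 := by positivity
  -- Summation by parts against the bounded partial sums `G` of `u` minus its mean value `a`.
  set a : ℝ := (∑ f ∈ Finset.range M, u f) / M with ha
  set G : ℕ → ℝ := fun y => ∑ f ∈ Finset.range y, (u f - a) with hG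
  have hGper : Function.Periodic G M := by
    intro y
    induction y with
    | zero => simp [hG, ha, mul_div_cancel₀ _ hM0]
    | succ y ih =>
      have h1 : G (y + 1 + M) = G (y + M) + (u (y + M) - a) := by
        simp only [hG, show y + 1 + M = y + M + 1 by ring, Finset.sum_range_succ]
      have h2 : G (y + 1) = G y + (u y - a) := by simp only [hG, Finset.sum_range_succ]
      rw [h1, h2, ih, hu]
  obtain ⟨B, hB⟩ : ∃ B, ∀ y, |G y| ≤ B := by
    refine ⟨∑ y ∈ Finset.range M, |G y|, fun y => ?_⟩
    rw [← hGper.map_mod_nat y]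
    exact Finset.single_le_sum (f := fun y => |G y|) (fun i _ => abs_nonneg _)
      (Finset.mem_range.2 (Nat.mod_lt _ hM))
  have hparts : ∀ y : ℕ, ∑ f ∈ Finset.Ioc 0 y, u f * f =
      a * ((y : ℝ) * (y + 1) / 2) + (((y : ℝ) + 1) * G (y + 1)
        - ∑ f ∈ Finset.range (y + 1), G (f + 1)) := by
    intro y
    induction y with
    | zero => simp
    | succ y ih =>
      rw [← Finset.insert_Ioc_right_eq_Ioc_add_one (Nat.zero_le y), Finset.sum_insert (by simp),
        ih, Finset.sum_range_succ _ (y + 1)]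
      have h2 : G (y + 1 + 1) = G (y + 1) + (u (y + 1) - a) := by
        simp only [hG, Finset.sum_range_succ]
      rw [h2]
      push_cast
      ring
  have hlim1 : Tendsto (fun y : ℕ => a / 2 * (1 + 1 / (y : ℝ))) atTop (nhds (a / 2)) := by
    have h := (tendsto_one_div_atTop_nhds_zero_nat (𝕜 := ℝ)).const_add 1
    simpa using h.const_mul (a / 2)
  have hlim2 : Tendsto (fun y : ℕ => ((((y : ℝ) + 1) * G (y + 1)
        - ∑ f ∈ Finset.range (y + 1), G (f + 1))) / (y : ℝ) ^ 2) atTop (nhds 0) := by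
    have hB0 : 0 ≤ B := (abs_nonneg _).trans (hB 0)
    refine squeeze_zero_norm' (a := fun y : ℕ => 4 * B * (1 / (y : ℝ))) ?_ ?_
    · filter_upwards [eventually_ge_atTop 1] with y hy
      have hy' : (1 : ℝ) ≤ y := by exact_mod_cast hy
      have hsum : |∑ f ∈ Finset.range (y + 1), G (f + 1)| ≤ (y + 1) * B := by
        refine (Finset.abs_sum_le_sum_abs _ _).trans ?_
        refine (Finset.sum_le_sum fun f _ => hB (f + 1)).trans ?_
        simp
      have hfst : |((y : ℝ) + 1) * G (y + 1)| ≤ (y + 1) * B := by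
        rw [abs_mul, abs_of_nonneg (by positivity)]
        exact mul_le_mul_of_nonneg_left (hB _) (by positivity)
      have htot := (abs_sub _ _).trans (add_le_add hfst hsum)
      rw [Real.norm_eq_abs, abs_div, abs_of_nonneg (by positivity : (0 : ℝ) ≤ (y : ℝ) ^ 2),
        div_le_iff₀ (by positivity)]
      refine htot.trans ?_
      have : 4 * B * (1 / (y : ℝ)) * (y : ℝ) ^ 2 = 4 * B * y := by field_simp
      rw [this]
      nlinarith
    · simpa using (tendsto_one_div_atTop_nhds_zero_nat (𝕜 := ℝ)).const_mul (4 * B)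
  have hadd := hlim1.add hlim2
  rw [add_zero] at hadd
  refine hadd.congr' ?_
  filter_upwards [eventually_ge_atTop 1] with y hy
  have hy' : (y : ℝ) ≠ 0 := by positivity
  rw [hparts, add_div]
  congr 1
  field_simp

theorem sum_Ioc_sum_divisorsAntidiagonal (F : ℕ → ℕ → ℝ) (N : ℕ) :
    ∑ d ∈ Finset.Ioc 0 N, ∑ x ∈ d.divisorsAntidiagonal, F x.1 x.2 =
      ∑ e ∈ Finset.Ioc 0 N, ∑ f ∈ Finset.Ioc 0 (N / e), F e f := by
  trans ∑ x ∈ Finset.Ioc 0 N ×ˢ Finset.Ioc 0 N with x.1 * x.2 ≤ N, F x.1 x.2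
  · trans ∑ d ∈ Finset.Ioc 0 N,
      ∑ x ∈ Finset.Ioc 0 N ×ˢ Finset.Ioc 0 N with x.1 * x.2 = d, F x.1 x.2
    · refine Finset.sum_congr rfl fun n hn => ?_
      simp only [Finset.mem_Ioc] at hn
      rw [Nat.divisorsAntidiagonal_eq_prod_filter_of_le hn.1.ne' hn.2]
    · simp_rw [Finset.sum_filter]
      rw [Finset.sum_comm]
      exact Finset.sum_congr rfl fun _ _ => (by simp_all)
  · rw [Finset.sum_filter, Finset.sum_product]
    refine Finset.sum_congr rfl fun e he => ?_
    rw [← Finset.sum_filter]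
    refine Finset.sum_congr ?_ fun _ _ => rfl
    ext f
    simp only [Finset.mem_filter, Finset.mem_Ioc] at he ⊢
    rw [Nat.le_div_iff_mul_le he.1, mul_comm f e]
    constructor
    · rintro ⟨⟨h1, _⟩, h2⟩
      exact ⟨h1, h2⟩
    · rintro ⟨h1, h2⟩
      exact ⟨⟨h1, (Nat.le_mul_of_pos_left f he.1).trans h2⟩, h2⟩

/-- The Möbius function restricted to the integers coprime to `M`. -/
def coprimeMoebius (M e : ℕ) : ℝ := if e.Coprime M then (ArithmeticFunction.moebius e : ℝ) else 0

theorem abs_coprimeMoebius_le_one (M e : ℕ) : |coprimeMoebius M e| ≤ 1 := by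
  unfold coprimeMoebius
  split_ifs
  · exact_mod_cast ArithmeticFunction.abs_moebius_le_one
  · simp

/-- The function `e ↦ 1/e` restricted to the integers coprime to `M`. -/
noncomputable def coprimeInv (M : ℕ) : ArithmeticFunction ℝ :=
  ⟨fun e => if e = 0 then 0 else if e.Coprime M then (e : ℝ)⁻¹ else 0, by simp⟩

theorem coprimeInv_isMultiplicative (M : ℕ) : (coprimeInv M).IsMultiplicative := by
  refine ArithmeticFunction.IsMultiplicative.iff_ne_zero.2 ⟨by simp [coprimeInv], ?_⟩
  intro m n hm hn _
  simp only [coprimeInv, ArithmeticFunction.coe_mk, mul_eq_zero, hm, hn, or_self, if_false,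
    Nat.coprime_mul_iff_left]
  by_cases h1 : m.Coprime M
  · by_cases h2 : n.Coprime M
    · rw [if_pos ⟨h1, h2⟩, if_pos h1, if_pos h2, Nat.cast_mul, mul_inv]
    · rw [if_neg fun h => h2 h.2, if_neg h2, mul_zero]
  · rw [if_neg fun h => h1 h.1, if_neg h1, zero_mul]

theorem sum_divisors_coprimeMoebius_div (M : ℕ) {d : ℕ} (hd : d ≠ 0) :
    ∑ e ∈ d.divisors, coprimeMoebius M e * (e : ℝ)⁻¹ =
      ∏ p ∈ d.primeFactors, (1 - if p ∣ M then 0 else (p : ℝ)⁻¹) := by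
  set R := ∏ p ∈ d.primeFactors, p with hR
  have hR0 : R ≠ 0 := Finset.prod_ne_zero_iff.2 fun p hp =>
    (Nat.prime_of_mem_primeFactors hp).ne_zero
  have hRsq : Squarefree R := by
    rw [hR, ← Nat.radical_eq_prod_primeFactors]
    exact UniqueFactorizationMonoid.squarefree_radical
  have hprod : ∏ p ∈ d.primeFactors, (1 - if p ∣ M then 0 else (p : ℝ)⁻¹) =
      ∏ p ∈ R.primeFactors, (1 - coprimeInv M p) := by
    rw [hR, Nat.primeFactors_prod_primeFactors]
    refine Finset.prod_congr rfl fun p hp => ?_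
    have hpp := Nat.prime_of_mem_primeFactors hp
    by_cases hpM : p ∣ M <;>
      simp [coprimeInv, hpp.ne_zero, hpp.coprime_iff_not_dvd, hpM]
  rw [hprod, (coprimeInv_isMultiplicative M).prodPrimeFactors_one_sub_of_squarefree _ hRsq]
  have hRd : R ∣ d := Nat.prod_primeFactors_dvd d
  symm
  refine (Finset.sum_subset (Nat.divisors_subset_of_dvd hd hRd) ?_).trans
    (Finset.sum_congr rfl ?_)
  · intro e he hne
    rw [ArithmeticFunction.moebius_eq_zero_of_not_squarefree, Int.cast_zero, zero_mul]
    intro hsq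
    refine hne (Nat.mem_divisors.2 ⟨?_, hR0⟩)
    rw [← Nat.prod_primeFactors_of_squarefree hsq]
    exact Finset.prod_dvd_prod_of_subset _ _ _
      (Nat.primeFactors_mono (Nat.dvd_of_mem_divisors he) hd)
  · intro e he
    have he0 : e ≠ 0 := (Nat.pos_of_mem_divisors he).ne'
    by_cases hc : e.Coprime M <;> simp [coprimeMoebius, coprimeInv, he0, hc]

theorem totient_eq_mul_prod_real (n : ℕ) :
    (n.totient : ℝ) = n * ∏ p ∈ n.primeFactors, (1 - (p : ℝ)⁻¹) := by
  have h := congrArg (Rat.cast : ℚ → ℝ) (Nat.totient_eq_mul_prod_factors n)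
  push_cast at h
  exact h

/-- The Euler product of `φ(d)`, with the factors of the primes dividing `M` split off. These
depend on `d` through `gcd d M` only. -/
theorem totient_eq_ratio_mul_sum (M : ℕ) {d : ℕ} (hd : d ≠ 0) :
    (d.totient : ℝ) = (d.gcd M).totient / (d.gcd M : ℕ) *
      ∑ x ∈ d.divisorsAntidiagonal, coprimeMoebius M x.1 * x.2 := by
  have hg : d.gcd M ≠ 0 := Nat.gcd_ne_zero_left hd
  have hg' : ((d.gcd M : ℕ) : ℝ) ≠ 0 := by exact_mod_cast hg
  have hsum : ∑ x ∈ d.divisorsAntidiagonal, coprimeMoebius M x.1 * (x.2 : ℝ) =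
      d * ∑ e ∈ d.divisors, coprimeMoebius M e * (e : ℝ)⁻¹ := by
    rw [Nat.sum_divisorsAntidiagonal (f := fun a b => coprimeMoebius M a * (b : ℝ)),
      Finset.mul_sum]
    refine Finset.sum_congr rfl fun e he => ?_
    have he0 : (e : ℝ) ≠ 0 := by exact_mod_cast (Nat.pos_of_mem_divisors he).ne'
    rw [Nat.cast_div (Nat.dvd_of_mem_divisors he) he0]
    ring
  rw [hsum, sum_divisors_coprimeMoebius_div M hd, totient_eq_mul_prod_real d,
    totient_eq_mul_prod_real (d.gcd M), mul_div_cancel_left₀ _ hg']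
  have hpf : (d.gcd M).primeFactors = d.primeFactors.filter (· ∣ M) := by
    ext p
    simp only [Nat.mem_primeFactors, Finset.mem_filter, Nat.dvd_gcd_iff]
    tauto
  rw [hpf, Finset.prod_filter, mul_left_comm, ← Finset.prod_mul_distrib]
  congr 1
  refine Finset.prod_congr rfl fun p _ => ?_
  split_ifs <;> simp

theorem tendsto_nat_div_div {e : ℕ} (he : e ≠ 0) :
    Tendsto (fun n : ℕ => ((n / e : ℕ) : ℝ) / n) atTop (nhds (1 / e)) := by
  have h := (tendsto_nat_floor_mul_div_atTop (R := ℝ) (a := 1 / (e : ℝ)) (by positivity)).comp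
    tendsto_natCast_atTop_atTop
  refine h.congr fun n => ?_
  simp only [Function.comp]
  rw [← Nat.floor_div_eq_div (K := ℝ), one_div_mul_eq_div]

/-- The value `∑ μ(e) / e ^ 2`, over the integers `e` coprime to `M`. -/
noncomputable def coprimeMoebiusSum (M : ℕ) : ℝ := ∑' e : ℕ, coprimeMoebius M e / (e : ℝ) ^ 2

theorem sum_range_mul_mod_eq {e M r : ℕ} (hr : r < M) (he : e.Coprime M) :
    ∑ f ∈ Finset.range M, (if e * f % M = r then (1 : ℝ) else 0) = 1 := by
  have hM : 0 < M := (Nat.zero_le r).trans_lt hr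
  have hinj : Set.InjOn (fun f => e * f % M) (Finset.range M : Set ℕ) := by
    intro f hf f' hf' h
    rw [Finset.coe_range, Set.mem_Iio] at hf hf'
    have h1 : e * f ≡ e * f' [MOD M] := h
    have h2 := Nat.ModEq.cancel_left_of_coprime he.symm h1
    rwa [Nat.ModEq, Nat.mod_eq_of_lt hf, Nat.mod_eq_of_lt hf'] at h2
  have himage : (Finset.range M).image (fun f => e * f % M) = Finset.range M := by
    refine Finset.eq_of_subset_of_card_le ?_ ?_
    · intro x hx
      obtain ⟨f, _, rfl⟩ := Finset.mem_image.1 hx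
      exact Finset.mem_range.2 (Nat.mod_lt _ hM)
    · rw [Finset.card_image_of_injOn hinj]
  calc ∑ f ∈ Finset.range M, (if e * f % M = r then (1 : ℝ) else 0)
      = ∑ x ∈ (Finset.range M).image (fun f => e * f % M), (if x = r then (1 : ℝ) else 0) :=
        (Finset.sum_image (f := fun x => if x = r then (1 : ℝ) else 0) hinj).symm
    _ = 1 := by
      rw [himage, Finset.sum_ite_eq' (Finset.range M) r, if_pos (Finset.mem_range.2 hr)]

/-- The limit for a residue class, in terms of the Möbius function. For `e` coprime to `M`, the
condition `e f ≡ r` modulo `M` on `f` has density `1 / M`, and dominated convergence sums over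
`e`. -/
theorem tendsto_sum_totient_mod_coprimeMoebius {M r : ℕ} (hr : r < M) :
    Tendsto (fun n : ℕ => (∑ d ∈ Finset.Ioc 0 n with d % M = r, (d.totient : ℝ)) / (n : ℝ) ^ 2)
      atTop (nhds ((r.gcd M).totient / (r.gcd M : ℕ) * (coprimeMoebiusSum M / (2 * M)))) := by
  have hM : 0 < M := (Nat.zero_le r).trans_lt hr
  set F : ℕ → ℕ → ℝ := fun n e => coprimeMoebius M e *
    ((∑ f ∈ Finset.Ioc 0 (n / e), (if e * f % M = r then (1 : ℝ) else 0) * f) / (n : ℝ) ^ 2)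
    with hF
  have hexp : ∀ n : ℕ, (∑ d ∈ Finset.Ioc 0 n with d % M = r, (d.totient : ℝ)) / (n : ℝ) ^ 2 =
      (r.gcd M).totient / (r.gcd M : ℕ) * ∑' e, F n e := by
    intro n
    have htsum : ∑' e, F n e = ∑ e ∈ Finset.Ioc 0 n, F n e := by
      refine tsum_eq_sum fun e he => ?_
      have h0 : n / e = 0 := by
        rw [Finset.mem_Ioc, not_and_or] at he
        rcases he with he | he
        · rw [Nat.eq_zero_of_not_pos he, Nat.div_zero]
        · exact Nat.div_eq_of_lt (not_le.1 he)
      simp [hF, h0]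
    have hdouble := sum_Ioc_sum_divisorsAntidiagonal
      (fun e f => coprimeMoebius M e * ((if e * f % M = r then (1 : ℝ) else 0) * f)) n
    have hF' : ∑ e ∈ Finset.Ioc 0 n, F n e = (∑ e ∈ Finset.Ioc 0 n, ∑ f ∈ Finset.Ioc 0 (n / e),
        coprimeMoebius M e * ((if e * f % M = r then (1 : ℝ) else 0) * f)) / (n : ℝ) ^ 2 := by
      rw [Finset.sum_div]
      refine Finset.sum_congr rfl fun e _ => ?_
      rw [hF, ← Finset.mul_sum, mul_div_assoc]
    rw [htsum, hF', ← hdouble, ← mul_div_assoc, Finset.mul_sum, Finset.sum_filter]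
    congr 1
    refine Finset.sum_congr rfl fun d hd => ?_
    have hd0 : d ≠ 0 := (Finset.mem_Ioc.1 hd).1.ne'
    have hx : ∑ x ∈ d.divisorsAntidiagonal,
        coprimeMoebius M x.1 * ((if x.1 * x.2 % M = r then (1 : ℝ) else 0) * x.2) =
        if d % M = r then ∑ x ∈ d.divisorsAntidiagonal, coprimeMoebius M x.1 * (x.2 : ℝ)
          else 0 := by
      split_ifs with h
      · refine Finset.sum_congr rfl fun x hx => ?_
        rw [(Nat.mem_divisorsAntidiagonal.1 hx).1, if_pos h, one_mul]
      · refine Finset.sum_eq_zero fun x hx => ?_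
        rw [(Nat.mem_divisorsAntidiagonal.1 hx).1, if_neg h, zero_mul, mul_zero]
    rw [hx]
    split_ifs with h
    · have hgcd : r.gcd M = d.gcd M := by
        rw [← h, Nat.gcd_comm d M, Nat.gcd_rec M d]
      rw [hgcd]
      exact totient_eq_ratio_mul_sum M hd0
    · rw [mul_zero]
  simp_rw [hexp]
  refine Tendsto.const_mul _ ?_
  have hlimit : coprimeMoebiusSum M / (2 * M) =
      ∑' e : ℕ, coprimeMoebius M e / (e : ℝ) ^ 2 / (2 * M) := by
    rw [coprimeMoebiusSum, tsum_div_const]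
  rw [hlimit]
  refine tendsto_tsum_of_dominated_convergence (bound := fun e : ℕ => 1 / (e : ℝ) ^ 2)
    (Real.summable_one_div_nat_pow.2 (by norm_num)) ?_ ?_
  · intro e
    rcases Nat.eq_zero_or_pos e with rfl | he
    · simp [hF]
    by_cases hc : e.Coprime M
    · have hper := tendsto_sum_periodic_mul_self
        (u := fun f => if e * f % M = r then (1 : ℝ) else 0) hM (fun f => by
          simp only [mul_add, Nat.add_mul_mod_self_right])
      rw [sum_range_mul_mod_eq hr hc] at hper
      have hcomp := hper.comp (Nat.tendsto_div_const_atTop he.ne')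
      have hmul := ((hcomp.mul ((tendsto_nat_div_div he.ne').pow 2))).const_mul
        (coprimeMoebius M e)
      have hval : coprimeMoebius M e / (e : ℝ) ^ 2 / (2 * M) =
          coprimeMoebius M e * (1 / (M : ℝ) / 2 * (1 / (e : ℝ)) ^ 2) := by
        field_simp
      rw [hval]
      refine hmul.congr' ?_
      filter_upwards [eventually_ge_atTop e] with n hn
      have hq : ((n / e : ℕ) : ℝ) ≠ 0 := by
        exact_mod_cast (Nat.div_pos hn he).ne'
      have hn0 : (n : ℝ) ≠ 0 := by
        exact_mod_cast (he.trans_le hn).ne'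
      simp only [hF, Function.comp]
      field_simp
    · simp [hF, coprimeMoebius, hc]
  · filter_upwards [eventually_ge_atTop 1] with n hn e
    have hn0 : (0 : ℝ) < n := by exact_mod_cast hn
    rcases Nat.eq_zero_or_pos e with rfl | he
    · simp [hF]
    have he0 : (0 : ℝ) < e := by exact_mod_cast he
    have hS0 : 0 ≤ ∑ f ∈ Finset.Ioc 0 (n / e), (if e * f % M = r then (1 : ℝ) else 0) * f :=
      Finset.sum_nonneg fun f _ => by positivity
    have hdiv : ((n / e : ℕ) : ℝ) ≤ n / e := Nat.cast_div_le
    have hS1 : ∑ f ∈ Finset.Ioc 0 (n / e), (if e * f % M = r then (1 : ℝ) else 0) * f ≤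
        ((n / e : ℕ) : ℝ) * ((n / e : ℕ) : ℝ) := by
      refine (Finset.sum_le_card_nsmul _ _ ((n / e : ℕ) : ℝ) ?_).trans_eq (by simp)
      intro f hf
      have hf' : (f : ℝ) ≤ ((n / e : ℕ) : ℝ) := by exact_mod_cast (Finset.mem_Ioc.1 hf).2
      split_ifs
      · simpa using hf'
      · simp
    rw [hF, norm_mul, Real.norm_eq_abs, Real.norm_eq_abs,
      abs_of_nonneg (div_nonneg hS0 (by positivity))]
    refine (mul_le_of_le_one_left (by positivity) (abs_coprimeMoebius_le_one M e)).trans ?_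
    rw [div_le_div_iff₀ (by positivity) (by positivity), one_mul]
    have h2 : ((n / e : ℕ) : ℝ) * e ≤ n := by
      rwa [le_div_iff₀ he0] at hdiv
    calc _ ≤ ((n / e : ℕ) : ℝ) * ((n / e : ℕ) : ℝ) * (e : ℝ) ^ 2 := by gcongr
      _ = (((n / e : ℕ) : ℝ) * e) ^ 2 := by ring
      _ ≤ (n : ℝ) ^ 2 := by gcongr

theorem coprimeMoebiusSum_one : coprimeMoebiusSum 1 = 6 / Real.pi ^ 2 := by
  have h := ArithmeticFunction.LSeries_zeta_mul_Lseries_moebius (s := 2) (by norm_num)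
  have h2 : LSeries (fun n => ((ArithmeticFunction.moebius n : ℤ) : ℂ)) 2 =
      (coprimeMoebiusSum 1 : ℂ) := by
    rw [LSeries, coprimeMoebiusSum, Complex.ofReal_tsum]
    refine tsum_congr fun n => ?_
    rcases Nat.eq_zero_or_pos n with rfl | hn
    · simp
    · rw [LSeries.term_of_ne_zero hn.ne']
      simp [coprimeMoebius]
  rw [h2, ArithmeticFunction.LSeries_zeta_eq_riemannZeta (by norm_num), riemannZeta_two] at h
  have h3 : Real.pi ^ 2 / 6 * coprimeMoebiusSum 1 = 1 := by exact_mod_cast h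
  have hpi := Real.pi_pos
  field_simp at h3 ⊢
  linarith

/-- The natural number `M φ(G) / G` for `G = gcd r M`. It is proportional to the density of
the residue class `r` modulo `M` with respect to the weight `φ`. -/
def classWeight (M r : ℕ) : ℕ := (r.gcd M).totient * (M / r.gcd M)

theorem classWeight_pos {M : ℕ} (hM : 0 < M) (r : ℕ) : 0 < classWeight M r := by
  have hg : 0 < r.gcd M := Nat.gcd_pos_of_pos_right _ hM
  exact Nat.mul_pos (Nat.totient_pos.2 hg)
    (Nat.div_pos (Nat.le_of_dvd hM (Nat.gcd_dvd_right r M)) hg)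

/-- Distribution of Euler's function over residue classes. The constants of the classes are
proportional to `classWeight M r`, and they add up to the constant `3 / π ^ 2` of the full sum. -/
theorem tendsto_sum_totient_mod {M r : ℕ} (hr : r < M) :
    Tendsto (fun n : ℕ => (∑ d ∈ Finset.Ioc 0 n with d % M = r, (d.totient : ℝ)) / (n : ℝ) ^ 2)
      atTop (nhds (3 / Real.pi ^ 2 *
        (classWeight M r / (∑ i ∈ Finset.range M, classWeight M i : ℕ)))) := by
  have hM : 0 < M := (Nat.zero_le r).trans_lt hr
  have hM' : (M : ℝ) ≠ 0 := by positivity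
  have hw : ∀ i, ((i.gcd M).totient : ℝ) / (i.gcd M : ℕ) = classWeight M i / M := by
    intro i
    have hg : ((i.gcd M : ℕ) : ℝ) ≠ 0 := by
      exact_mod_cast (Nat.gcd_pos_of_pos_right i hM).ne'
    rw [classWeight, Nat.cast_mul, Nat.cast_div (Nat.gcd_dvd_right i M) hg]
    field_simp
  have hfull := tendsto_sum_totient_mod_coprimeMoebius (M := 1) (r := 0) one_pos
  have hsplit := tendsto_finsetSum (Finset.range M) fun i hi =>
    tendsto_sum_totient_mod_coprimeMoebius (M := M) (r := i) (Finset.mem_range.1 hi)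
  have heq : (fun n : ℕ => ∑ i ∈ Finset.range M,
      (∑ d ∈ Finset.Ioc 0 n with d % M = i, (d.totient : ℝ)) / (n : ℝ) ^ 2) =
      fun n : ℕ => (∑ d ∈ Finset.Ioc 0 n with d % 1 = 0, (d.totient : ℝ)) / (n : ℝ) ^ 2 := by
    funext n
    rw [← Finset.sum_div]
    congr 1
    rw [Finset.filter_true_of_mem fun d _ => Nat.mod_one d]
    exact Finset.sum_fiberwise_of_maps_to
      (fun d _ => Finset.mem_range.2 (Nat.mod_lt d hM)) _
  rw [heq] at hsplit
  have huniq := tendsto_nhds_unique hsplit hfull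
  have hsum0 : 0 < ∑ i ∈ Finset.range M, classWeight M i :=
    Finset.sum_pos (fun i _ => classWeight_pos hM i) ⟨r, Finset.mem_range.2 hr⟩
  have hsum0' : ((∑ i ∈ Finset.range M, classWeight M i : ℕ) : ℝ) ≠ 0 := by
    exact_mod_cast hsum0.ne'
  have hconst : coprimeMoebiusSum M / (2 * M) =
      3 / Real.pi ^ 2 * (M / (∑ i ∈ Finset.range M, classWeight M i : ℕ)) := by
    simp_rw [hw] at huniq
    rw [← Finset.sum_mul, ← Finset.sum_div, ← Nat.cast_sum, coprimeMoebiusSum_one] at huniq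
    norm_num at huniq
    rw [← Nat.cast_sum] at huniq
    have hpi := Real.pi_pos
    field_simp at huniq ⊢
    linarith
  have := tendsto_sum_totient_mod_coprimeMoebius hr
  rw [hw, hconst] at this
  convert this using 2
  field_simp

/-! ### The least common multiple and the von Mangoldt function -/

theorem Nat.Prime.pow_dvd_lcm_iff {p i a b : ℕ} (hp : p.Prime) :
    p ^ i ∣ a.lcm b ↔ p ^ i ∣ a ∨ p ^ i ∣ b := by
  rcases eq_or_ne a 0 with rfl | ha
  · simp
  rcases eq_or_ne b 0 with rfl | hb
  · simp
  rw [hp.pow_dvd_iff_le_factorization (Nat.lcm_ne_zero ha hb),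
    hp.pow_dvd_iff_le_factorization ha, hp.pow_dvd_iff_le_factorization hb,
    Nat.factorization_lcm ha hb, Finsupp.sup_apply, le_sup_iff]

theorem Finset.natAbs_lcm {ι : Type*} (S : Finset ι) (f : ι → ℤ) :
    (S.lcm f).natAbs = S.lcm fun k => (f k).natAbs := by
  classical
  induction S using Finset.induction_on with
  | empty => simp
  | insert a S _ ih =>
    rw [Finset.lcm_insert, Finset.lcm_insert, Int.natAbs_lcm, Int.lcm_eq_natAbs_lcm_natAbs, ih]
    rfl

theorem Nat.Prime.pow_dvd_finset_lcm_iff {ι : Type*} {p i : ℕ} (hp : p.Prime) (hi : i ≠ 0)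
    (S : Finset ι) (f : ι → ℕ) : p ^ i ∣ S.lcm f ↔ ∃ k ∈ S, p ^ i ∣ f k := by
  classical
  induction S using Finset.induction_on with
  | empty => simp [hi, hp.ne_one]
  | insert a S _ ih =>
    rw [Finset.lcm_insert, lcm_eq_nat_lcm, hp.pow_dvd_lcm_iff, ih]
    simp

theorem fib_lt_two_pow (n : ℕ) : Nat.fib n < 2 ^ n := by
  induction n using Nat.twoStepInduction with
  | zero => simp
  | one => simp
  | more n h1 h2 =>
    rw [Nat.fib_add_two, pow_succ] at *
    have h3 : 2 ^ (n + 1) = 2 * 2 ^ n := by ring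
    omega

theorem abs_log_fib_sub_le {m : ℕ} (hm : m ≠ 0) :
    |Real.log (Nat.fib m) - m * Real.log Real.goldenRatio| ≤ 2 * Real.log Real.goldenRatio := by
  obtain ⟨n, rfl⟩ := Nat.exists_eq_succ_of_ne_zero hm
  rw [Nat.succ_eq_add_one]
  have hφ := Real.goldenRatio_pos
  have hlog : 0 < Real.log Real.goldenRatio := Real.log_pos Real.one_lt_goldenRatio
  have hF : (0 : ℝ) < Nat.fib (n + 1) := by exact_mod_cast Nat.fib_pos.2 n.succ_pos
  have hid := Real.goldenRatio_mul_fib_succ_add_fib n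
  have hmono : (Nat.fib n : ℝ) ≤ Nat.fib (n + 1) := by exact_mod_cast Nat.fib_le_fib_succ
  have h0 : (0 : ℝ) ≤ Nat.fib n := by positivity
  have hupper : Real.goldenRatio * Nat.fib (n + 1) ≤ Real.goldenRatio ^ (n + 1) := by linarith
  have hlower : Real.goldenRatio ^ (n + 1) ≤ Real.goldenRatio ^ 2 * Nat.fib (n + 1) := by
    rw [Real.goldenRatio_sq, ← hid]
    linarith
  have h1 := Real.log_le_log (by positivity) hupper
  have h2 := Real.log_le_log (by positivity) hlower
  rw [Real.log_mul (by positivity) hF.ne', Real.log_pow] at h1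
  rw [Real.log_mul (by positivity) hF.ne', Real.log_pow, Real.log_pow] at h2
  rw [abs_le]
  push_cast at h1 h2 ⊢
  constructor <;> linarith

/-- The logarithm of the primitive part of `F_d`: the sum of the von Mangoldt function over the
divisors of `F_d` whose rank of apparition is exactly `d`. -/
noncomputable def logPrimitivePart (d : ℕ) : ℝ :=
  ∑ q ∈ (Nat.fib d).divisors with fibRank q = d, ArithmeticFunction.vonMangoldt q

theorem sum_divisors_logPrimitivePart {m : ℕ} (hm : 0 < m) :
    ∑ d ∈ m.divisors, logPrimitivePart d = Real.log (Nat.fib m) := by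
  have hF : Nat.fib m ≠ 0 := (Nat.fib_pos.2 hm).ne'
  rw [← ArithmeticFunction.vonMangoldt_sum, ← Finset.sum_fiberwise_of_maps_to (t := m.divisors)
    (g := fibRank) (fun q hq => Nat.mem_divisors.2
      ⟨dvd_fib_iff.1 (Nat.dvd_of_mem_divisors hq), hm.ne'⟩)]
  refine Finset.sum_congr rfl fun d hd => Finset.sum_congr ?_ fun _ _ => rfl
  have hd0 : Nat.fib d ≠ 0 := (Nat.fib_pos.2 (Nat.pos_of_mem_divisors hd)).ne'
  ext q
  simp only [Finset.mem_filter, Nat.mem_divisors, hF, hd0, ne_eq, not_false_eq_true, and_true,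
    dvd_fib_iff]
  constructor
  · rintro ⟨_, rfl⟩
    exact ⟨Nat.dvd_of_mem_divisors hd, rfl⟩
  · rintro ⟨_, rfl⟩
    exact ⟨dvd_rfl, rfl⟩

/-- Möbius inversion of `log F_m = m log α + O(1)`. -/
theorem abs_logPrimitivePart_sub_le {d : ℕ} (hd : 0 < d) :
    |logPrimitivePart d - Real.log Real.goldenRatio * d.totient| ≤
      2 * Real.log Real.goldenRatio * d.divisors.card := by
  have h1 := ArithmeticFunction.sum_eq_iff_sum_mul_moebius_eq.1
    (fun m hm => sum_divisors_logPrimitivePart hm) d hd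
  have h2 := ArithmeticFunction.sum_eq_iff_sum_mul_moebius_eq (R := ℝ)
    (f := fun n => (n.totient : ℝ)) (g := fun n => (n : ℝ)) |>.1
    (fun m _ => by exact_mod_cast Nat.sum_totient m) d hd
  rw [← h1, ← h2, Finset.mul_sum, ← Finset.sum_sub_distrib]
  refine (Finset.abs_sum_le_sum_abs _ _).trans ?_
  refine (Finset.sum_le_card_nsmul _ _ (2 * Real.log Real.goldenRatio) ?_).trans_eq ?_
  · intro x hx
    have hx0 : x.2 ≠ 0 := (Nat.pos_of_mem_divisors
      (Nat.snd_mem_divisors_of_mem_antidiagonal hx)).ne'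
    have heq : ((ArithmeticFunction.moebius x.1 : ℤ) : ℝ) * Real.log (Nat.fib x.2) -
        Real.log Real.goldenRatio * ((ArithmeticFunction.moebius x.1 : ℤ) * (x.2 : ℝ)) =
        (ArithmeticFunction.moebius x.1 : ℤ) *
          (Real.log (Nat.fib x.2) - x.2 * Real.log Real.goldenRatio) := by ring
    rw [heq, abs_mul]
    have hμ : |((ArithmeticFunction.moebius x.1 : ℤ) : ℝ)| ≤ 1 := by
      exact_mod_cast ArithmeticFunction.abs_moebius_le_one
    exact (mul_le_of_le_one_left (abs_nonneg _) hμ).trans (abs_log_fib_sub_le hx0)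
  · rw [nsmul_eq_mul, mul_comm]
    congr 2
    rw [← Nat.map_div_right_divisors, Finset.card_map]

theorem sum_card_divisors_le (N : ℕ) :
    ((∑ d ∈ Finset.Ioc 0 N, d.divisors.card : ℕ) : ℝ) ≤ N * (1 + Real.log N) := by
  have h := ArithmeticFunction.sum_Ioc_sigma0_eq_sum_div N
  simp only [ArithmeticFunction.sigma_zero_apply] at h
  rw [h, Nat.cast_sum]
  have hH := harmonic_le_one_add_log N
  rw [harmonic_eq_sum_Icc] at hH
  push_cast at hH
  calc ∑ e ∈ Finset.Ioc 0 N, ((N / e : ℕ) : ℝ) ≤ ∑ e ∈ Finset.Ioc 0 N, (N : ℝ) * (e : ℝ)⁻¹ := by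
        refine Finset.sum_le_sum fun e _ => ?_
        rw [← div_eq_mul_inv]
        exact Nat.cast_div_le
    _ = N * ∑ e ∈ Finset.Icc 1 N, (e : ℝ)⁻¹ := by
        rw [Finset.mul_sum]
        rfl
    _ ≤ _ := by gcongr

/-- The integers `d ≤ n + 2` with a multiple that accounts for one of the terms of index
`3, …, n`. -/
noncomputable def accountedSet (s : ℕ → ℤ) (n : ℕ) : Finset ℕ :=
  open Classical in
  {d ∈ Finset.Ioc 0 (n + 2) | ∃ k ∈ Finset.Icc 3 n, ∃ j e, 0 < j ∧ Accounts (s k) d j e k}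

theorem accountedSet_subset (s : ℕ → ℤ) (n : ℕ) : accountedSet s n ⊆ Finset.Ioc 0 (n + 2) := by
  intro d hd
  simp only [accountedSet, Finset.mem_filter] at hd
  exact hd.1

theorem mem_accountedSet_iff {s : ℕ → ℤ} {n d : ℕ} :
    d ∈ accountedSet s n ↔ ∃ k, 3 ≤ k ∧ k ≤ n ∧ ∃ j e, 0 < j ∧ Accounts (s k) d j e k := by
  simp only [accountedSet, Finset.mem_filter]
  constructor
  · rintro ⟨_, k, hk, h⟩
    rw [Finset.mem_Icc] at hk
    exact ⟨k, hk.1, hk.2, h⟩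
  · rintro ⟨k, h3, hn, j, e, hj, h⟩
    refine ⟨?_, k, Finset.mem_Icc.2 ⟨h3, hn⟩, j, e, hj, h⟩
    obtain ⟨he, _, hk, _⟩ := h
    have h1 : d ≤ j * d := Nat.le_mul_of_pos_left d hj
    rw [Finset.mem_Ioc]
    refine ⟨Nat.pos_of_ne_zero ?_, by omega⟩
    rintro rfl
    omega

theorem sum_vonMangoldt_two_three_le (N : ℕ) :
    ∑ q ∈ Finset.Ioc 0 (2 ^ N) with q.minFac < 5, ArithmeticFunction.vonMangoldt q ≤
      (2 * N + 2) * Real.log 3 := by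
  have hlog3 : 0 < Real.log 3 := Real.log_pos (by norm_num)
  set P := (Finset.range (N + 1)).image (fun i => 2 ^ i) ∪
    (Finset.range (N + 1)).image (fun i => 3 ^ i) with hP
  have hcard : (P.card : ℝ) ≤ 2 * N + 2 := by
    have h : P.card ≤ (N + 1) + (N + 1) := by
      refine (Finset.card_union_le _ _).trans ?_
      exact add_le_add (Finset.card_image_le.trans_eq (Finset.card_range _))
        (Finset.card_image_le.trans_eq (Finset.card_range _))
    have h' : (P.card : ℝ) ≤ ((N + 1 + (N + 1) : ℕ) : ℝ) := by exact_mod_cast h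
    push_cast at h'
    linarith
  have hbound : ∀ q, q.minFac < 5 → ArithmeticFunction.vonMangoldt q ≤ Real.log 3 := by
    intro q hq
    rw [ArithmeticFunction.vonMangoldt_apply]
    split_ifs with hpp
    · have hp := Nat.minFac_prime hpp.ne_one
      have h4 : q.minFac ≠ 4 := fun h => by rw [h] at hp; revert hp; norm_num
      exact Real.log_le_log (by exact_mod_cast hp.pos)
        (by exact_mod_cast (by omega : q.minFac ≤ 3))
    · exact hlog3.le
  have hsub : ∑ q ∈ Finset.Ioc 0 (2 ^ N) with q.minFac < 5, ArithmeticFunction.vonMangoldt q =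
      ∑ q ∈ P with q ∈ Finset.Ioc 0 (2 ^ N) ∧ q.minFac < 5, ArithmeticFunction.vonMangoldt q := by
    symm
    refine Finset.sum_subset (fun q hq => ?_) (fun q hq hnq => ?_)
    · rw [Finset.mem_filter] at hq ⊢
      exact hq.2
    · by_contra hne
      rw [← ne_eq, ArithmeticFunction.vonMangoldt_ne_zero_iff, isPrimePow_nat_iff] at hne
      obtain ⟨p, i, hp, hi, rfl⟩ := hne
      rw [Finset.mem_filter] at hq hnq
      refine hnq ⟨?_, hq⟩
      have hp5 : p < 5 := by
        have h := hq.2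
        rwa [Nat.Prime.pow_minFac hp hi.ne'] at h
      have hiN : i < N + 1 := by
        have hle := (Finset.mem_Ioc.1 hq.1).2
        have h2 : 2 ^ i ≤ 2 ^ N := (Nat.pow_le_pow_left hp.two_le i).trans hle
        exact Nat.lt_succ_of_le ((Nat.pow_le_pow_iff_right (by norm_num)).1 h2)
      have hp23 : p = 2 ∨ p = 3 := by
        have := hp.two_le
        have h4 : p ≠ 4 := by rintro rfl; revert hp; norm_num
        omega
      rw [hP, Finset.mem_union]
      rcases hp23 with rfl | rfl
      · exact Or.inl (Finset.mem_image_of_mem _ (Finset.mem_range.2 hiN))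
      · exact Or.inr (Finset.mem_image_of_mem _ (Finset.mem_range.2 hiN))
  rw [hsub]
  calc _ ≤ ((P.filter fun q => q ∈ Finset.Ioc 0 (2 ^ N) ∧ q.minFac < 5).card : ℕ) •
        Real.log 3 := Finset.sum_le_card_nsmul _ _ _ fun q hq =>
          hbound q (Finset.mem_filter.1 hq).2.2
    _ ≤ (P.card : ℝ) * Real.log 3 := by
      rw [nsmul_eq_mul]
      gcongr
      exact Finset.filter_subset _ _
    _ ≤ _ := by gcongr

theorem fib_add_sign_bounds {k : ℕ} {s : ℤ} (hk : 3 ≤ k) (hs : s = -1 ∨ s = 1) :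
    0 < (Nat.fib k : ℤ) + s ∧ (Nat.fib k : ℤ) + s ≤ 2 ^ k := by
  have h1 : Nat.fib 3 ≤ Nat.fib k := Nat.fib_mono hk
  have h3 : Nat.fib 3 = 2 := rfl
  have h2 := fib_lt_two_pow k
  zify at h1 h2 h3
  constructor <;> rcases hs with rfl | rfl <;> linarith

/-- The prime powers that divide the least common multiple are, up to powers of `2` and `3`, the
ones whose rank of apparition belongs to `accountedSet s n`. -/
theorem abs_log_lcm_sub_sum_logPrimitivePart_le {s : ℕ → ℤ}
    (hs : ∀ n, 1 ≤ n → s n = -1 ∨ s n = 1) (n : ℕ) :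
    |Real.log (shiftedFibLcm s n) - ∑ d ∈ accountedSet s n, logPrimitivePart d| ≤
      (2 * (n + 2 : ℕ) + 2) * Real.log 3 := by
  set K := (shiftedFibLcm s n).natAbs with hK
  have hKlcm : K = (Finset.Icc 3 n).lcm fun k => ((Nat.fib k : ℤ) + s k).natAbs :=
    Finset.natAbs_lcm _ _
  have hK0 : K ≠ 0 := by
    rw [hKlcm, ne_eq, Finset.lcm_eq_zero_iff]
    rintro ⟨k, hk, h0⟩
    rw [Finset.mem_Icc] at hk
    have := (fib_add_sign_bounds hk.1 (hs k (by omega))).1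
    omega
  have hlogK : Real.log (shiftedFibLcm s n) = Real.log K := by
    rw [hK, Nat.cast_natAbs, Int.cast_abs, Real.log_abs]
  have hdvd : ∀ q, IsPrimePow q → (q ∣ K ↔ ∃ k, 3 ≤ k ∧ k ≤ n ∧ (q : ℤ) ∣ Nat.fib k + s k) := by
    intro q hq
    obtain ⟨p, i, hp, hi, rfl⟩ := (isPrimePow_nat_iff q).1 hq
    rw [hKlcm, hp.pow_dvd_finset_lcm_iff hi.ne']
    simp only [Finset.mem_Icc, ← Int.natCast_dvd, and_assoc]
  set U := Finset.Ioc 0 (2 ^ (n + 2)) with hU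
  have hX : Real.log K = ∑ q ∈ U with q ∣ K, ArithmeticFunction.vonMangoldt q := by
    rw [← ArithmeticFunction.vonMangoldt_sum]
    symm
    refine Finset.sum_subset (fun q hq => ?_) (fun q hq hnq => ?_)
    · exact Nat.mem_divisors.2 ⟨(Finset.mem_filter.1 hq).2, hK0⟩
    · by_contra hne
      rw [← ne_eq, ArithmeticFunction.vonMangoldt_ne_zero_iff] at hne
      refine hnq (Finset.mem_filter.2 ⟨?_, Nat.dvd_of_mem_divisors hq⟩)
      obtain ⟨k, h3, hkn, hqk⟩ := (hdvd q hne).1 (Nat.dvd_of_mem_divisors hq)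
      obtain ⟨hpos, hle⟩ := fib_add_sign_bounds h3 (hs k (by omega))
      have h1 := (Int.le_of_dvd hpos hqk).trans hle
      have h2 : q ≤ 2 ^ k := by exact_mod_cast h1
      exact Finset.mem_Ioc.2 ⟨hne.pos,
        h2.trans (Nat.pow_le_pow_right (by norm_num) (by omega))⟩
  have hY : ∑ d ∈ accountedSet s n, logPrimitivePart d =
      ∑ q ∈ U with fibRank q ∈ accountedSet s n, ArithmeticFunction.vonMangoldt q := by
    rw [← Finset.sum_fiberwise_of_maps_to (t := accountedSet s n) (g := fibRank)
      (fun q hq => (Finset.mem_filter.1 hq).2)]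
    refine Finset.sum_congr rfl fun d hd => Finset.sum_congr ?_ fun _ _ => rfl
    have hdIoc : d ∈ Finset.Ioc 0 (n + 2) := accountedSet_subset s n hd
    rw [Finset.mem_Ioc] at hdIoc
    have hF : 0 < Nat.fib d := Nat.fib_pos.2 hdIoc.1
    ext q
    simp only [Finset.mem_filter, Nat.mem_divisors, hU, Finset.mem_Ioc, dvd_fib_iff]
    constructor
    · rintro ⟨⟨hq, _⟩, rfl⟩
      have hqF : q ∣ Nat.fib (fibRank q) := dvd_fib_iff.2 hq
      exact ⟨⟨⟨Nat.pos_of_dvd_of_pos hqF hF, ((Nat.le_of_dvd hF hqF).trans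
        (fib_lt_two_pow _).le).trans (Nat.pow_le_pow_right (by norm_num) hdIoc.2)⟩, hd⟩, rfl⟩
    · rintro ⟨_, rfl⟩
      exact ⟨⟨dvd_rfl, hF.ne'⟩, rfl⟩
  have hiff : ∀ q, IsPrimePow q → 5 ≤ q.minFac → (q ∣ K ↔ fibRank q ∈ accountedSet s n) := by
    intro q hq h5
    rw [hdvd q hq, mem_accountedSet_iff]
    obtain ⟨p, i, hp, hi, rfl⟩ := (isPrimePow_nat_iff q).1 hq
    rw [Nat.Prime.pow_minFac hp hi.ne'] at h5
    refine exists_congr fun k => and_congr_right fun hk => and_congr_right fun _ => ?_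
    exact prime_pow_dvd_fib_add_iff hp h5 hi.ne' hk (hs k (by omega))
  refine le_trans ?_ (sum_vonMangoldt_two_three_le (n + 2))
  rw [hlogK, hX, hY, Finset.sum_filter, Finset.sum_filter, Finset.sum_filter,
    ← Finset.sum_sub_distrib]
  refine (Finset.abs_sum_le_sum_abs _ _).trans (Finset.sum_le_sum fun q _ => ?_)
  have h0 : 0 ≤ ArithmeticFunction.vonMangoldt q := ArithmeticFunction.vonMangoldt_nonneg
  by_cases hq : IsPrimePow q
  · by_cases h5 : q.minFac < 5
    · rw [if_pos h5]
      split_ifs <;> simp [abs_of_nonneg h0, h0]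
    · simp [h5, hiff q hq (not_lt.1 h5)]
  · simp [ArithmeticFunction.vonMangoldt_eq_zero_iff.2 hq]

/-- The asymptotic reduction to Euler's function:
`log lcm = log α * ∑ φ(d) + o(n ^ 2)`, the sum over `accountedSet s n`. -/
theorem tendsto_log_lcm_sub_sum_totient {s : ℕ → ℤ} (hs : ∀ n, 1 ≤ n → s n = -1 ∨ s n = 1) :
    Tendsto (fun n : ℕ => (Real.log (shiftedFibLcm s n) - Real.log Real.goldenRatio *
      ∑ d ∈ accountedSet s n, (d.totient : ℝ)) / (n : ℝ) ^ 2) atTop (nhds 0) := by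
  set a := Real.log Real.goldenRatio with ha
  have ha0 : 0 < a := Real.log_pos Real.one_lt_goldenRatio
  have hlog3 : 0 < Real.log 3 := Real.log_pos (by norm_num)
  have hbound : ∀ n : ℕ, |Real.log (shiftedFibLcm s n) - a *
      ∑ d ∈ accountedSet s n, (d.totient : ℝ)| ≤
      (4 * Real.log 3 + 2 * a) * ((n + 2 : ℕ) * (1 + Real.log (n + 2 : ℕ))) := by
    intro n
    have h1 := abs_log_lcm_sub_sum_logPrimitivePart_le hs n
    have h2 : |∑ d ∈ accountedSet s n, logPrimitivePart d -
        a * ∑ d ∈ accountedSet s n, (d.totient : ℝ)| ≤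
        2 * a * ((n + 2 : ℕ) * (1 + Real.log (n + 2 : ℕ))) := by
      rw [Finset.mul_sum, ← Finset.sum_sub_distrib]
      refine (Finset.abs_sum_le_sum_abs _ _).trans ?_
      refine (Finset.sum_le_sum_of_subset_of_nonneg (accountedSet_subset s n)
        (fun _ _ _ => abs_nonneg _)).trans ?_
      refine (Finset.sum_le_sum fun d hd =>
        abs_logPrimitivePart_sub_le (Finset.mem_Ioc.1 hd).1).trans ?_
      rw [← Finset.mul_sum, ← Nat.cast_sum]
      exact mul_le_mul_of_nonneg_left (sum_card_divisors_le _) (by positivity)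
    have h3 := abs_add_le (Real.log (shiftedFibLcm s n) -
      ∑ d ∈ accountedSet s n, logPrimitivePart d) (∑ d ∈ accountedSet s n, logPrimitivePart d -
        a * ∑ d ∈ accountedSet s n, (d.totient : ℝ))
    rw [sub_add_sub_cancel] at h3
    have hN : (1 : ℝ) ≤ (n + 2 : ℕ) := by exact_mod_cast (by omega : 1 ≤ n + 2)
    have hlogN : 0 ≤ Real.log (n + 2 : ℕ) := Real.log_nonneg hN
    have h4 : (2 * ((n + 2 : ℕ) : ℝ) + 2) * Real.log 3 ≤
        4 * Real.log 3 * ((n + 2 : ℕ) * (1 + Real.log (n + 2 : ℕ))) := by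
      have h5 : (2 * ((n + 2 : ℕ) : ℝ) + 2) ≤ 4 * ((n + 2 : ℕ) * (1 + Real.log (n + 2 : ℕ))) := by
        nlinarith
      nlinarith
    linarith
  have hlim : Tendsto (fun N : ℕ => (1 + Real.log N) / (N : ℝ)) atTop (nhds 0) := by
    have h1 := (tendsto_one_div_atTop_nhds_zero_nat (𝕜 := ℝ))
    have h2 := (Real.isLittleO_log_id_atTop.tendsto_div_nhds_zero).comp
      (tendsto_natCast_atTop_atTop (R := ℝ))
    have h3 := h1.add h2
    rw [add_zero] at h3
    refine h3.congr fun N => ?_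
    simp [add_div]
  have hlim' := (hlim.comp (tendsto_add_atTop_nat 2)).const_mul ((4 * Real.log 3 + 2 * a) * 9)
  rw [mul_zero] at hlim'
  refine squeeze_zero_norm' ?_ hlim'
  filter_upwards [eventually_ge_atTop 1] with n hn
  have hn' : (1 : ℝ) ≤ n := by exact_mod_cast hn
  rw [Real.norm_eq_abs, abs_div, abs_of_nonneg (by positivity : (0 : ℝ) ≤ (n : ℝ) ^ 2),
    div_le_iff₀ (by positivity)]
  refine (hbound n).trans ?_
  have hN : (1 : ℝ) ≤ (n + 2 : ℕ) := by exact_mod_cast (by omega : 1 ≤ n + 2)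
  have hlogN : 0 ≤ Real.log (n + 2 : ℕ) := Real.log_nonneg hN
  have hsq : ((n + 2 : ℕ) : ℝ) ^ 2 ≤ 9 * (n : ℝ) ^ 2 := by
    push_cast
    nlinarith
  simp only [Function.comp]
  have hrew : (4 * Real.log 3 + 2 * a) * 9 * ((1 + Real.log (n + 2 : ℕ)) / ((n + 2 : ℕ) : ℝ)) *
      (n : ℝ) ^ 2 = (4 * Real.log 3 + 2 * a) *
      ((1 + Real.log (n + 2 : ℕ)) * (9 * (n : ℝ) ^ 2 / ((n + 2 : ℕ) : ℝ))) := by ring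
  rw [hrew]
  refine mul_le_mul_of_nonneg_left ?_ (by positivity)
  rw [mul_comm]
  refine mul_le_mul_of_nonneg_left ?_ (by positivity)
  rw [le_div_iff₀ (by positivity)]
  nlinarith

/-! ### Periodic sign sequences -/

/-- The letter of `w`, extended periodically to all natural indices. -/
def periodicLetter (w : List ℤ) (i : ℕ) : ℤ := w.getD (i % w.length) 0

/-- The sign `-(-1) ^ n * F_ε` for `ε = e - 2`. -/
def requiredSign (n e : ℕ) : ℤ := if (n + if e = 0 then 1 else 0) % 2 = 0 then -1 else 1

theorem requiredSign_eq (n e : ℕ) : requiredSign n e = -(-1) ^ n * fibOffset e := by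
  rw [requiredSign, fibOffset]
  rcases Nat.even_or_odd n with hn | hn
  · have h := Nat.even_iff.1 hn
    rw [hn.neg_one_pow]
    split_ifs <;> omega
  · have h := Nat.odd_iff.1 hn
    rw [hn.neg_one_pow]
    split_ifs <;> omega

/-- The sign at index `n + e - 2` is the one required by `Accounts` for `n = j * d`. The summand
`3 * (w.length - 1)` turns the shift by `-3` (the letter of index `i` is the sign of index
`i + 1`) into an addition of natural numbers. -/
def LetterMatches (w : List ℤ) (j n e : ℕ) : Prop :=
  periodicLetter w (n + e + 3 * (w.length - 1)) = requiredSign (j + n / 2) e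

/-- The word `w` has the sign required by `Accounts` for the multiple `j * d` of `d`, at one of the
four possible indices. -/
def Hits (w : List ℤ) (d j : ℕ) : Prop :=
  j * d % 2 = 0 ∧ (LetterMatches w j (j * d) 0 ∨ LetterMatches w j (j * d) 1 ∨
    LetterMatches w j (j * d) 3 ∨ LetterMatches w j (j * d) 4)

instance (w : List ℤ) (j n e : ℕ) : Decidable (LetterMatches w j n e) :=
  inferInstanceAs (Decidable (_ = _))

instance (w : List ℤ) (d j : ℕ) : Decidable (Hits w d j) :=
  inferInstanceAs (Decidable (_ ∧ _))

/-- A common period, in `d` and in `j`, of `Hits w d j`. -/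
def hitPeriod (w : List ℤ) : ℕ := 4 * w.length

/-- The least `j > 0` with `Hits w d j`, and `0` if there is none. A search up to the period
suffices. -/
def firstHit (w : List ℤ) (d : ℕ) : ℕ :=
  if (List.range (hitPeriod w)).findIdx (fun i => decide (Hits w d (i + 1))) < hitPeriod w then
    (List.range (hitPeriod w)).findIdx (fun i => decide (Hits w d (i + 1))) + 1
  else 0

theorem letterMatches_congr {w : List ℤ} {j j' n n' : ℕ} (hj : j % 2 = j' % 2)
    (hn : n % hitPeriod w = n' % hitPeriod w) (e : ℕ) :
    LetterMatches w j n e ↔ LetterMatches w j' n' e := by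
  have hT : n ≡ n' [MOD w.length] := Nat.ModEq.of_dvd (Dvd.intro_left 4 rfl) hn
  have h4 : n % 4 = n' % 4 := Nat.ModEq.of_dvd (Dvd.intro _ rfl : 4 ∣ hitPeriod w) hn
  have h1 : periodicLetter w (n + e + 3 * (w.length - 1)) =
      periodicLetter w (n' + e + 3 * (w.length - 1)) := by
    rw [periodicLetter, periodicLetter, ((hT.add_right e).add_right _ : _ ≡ _ [MOD w.length])]
  have h2 : requiredSign (j + n / 2) e = requiredSign (j' + n' / 2) e := by
    rw [requiredSign, requiredSign]
    have : ∀ c, (j + n / 2 + c) % 2 = (j' + n' / 2 + c) % 2 := fun c => by omega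
    rw [this]
  rw [LetterMatches, LetterMatches, h1, h2]

theorem hits_congr {w : List ℤ} {d d' j j' : ℕ} (hj : j % 2 = j' % 2)
    (hn : j * d % hitPeriod w = j' * d' % hitPeriod w) : Hits w d j ↔ Hits w d' j' := by
  have h2 : j * d % 2 = j' * d' % 2 :=
    Nat.ModEq.of_dvd ((by norm_num : 2 ∣ 4).mul_right _ : 2 ∣ hitPeriod w) hn
  rw [Hits, Hits, h2]
  simp only [letterMatches_congr hj hn]

theorem firstHit_mod (w : List ℤ) (d : ℕ) : firstHit w (d % hitPeriod w) = firstHit w d := by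
  have h : ∀ j, Hits w (d % hitPeriod w) j ↔ Hits w d j := fun j =>
    hits_congr rfl ((Nat.mod_modEq d (hitPeriod w)).mul_left j)
  simp only [firstHit, h]

theorem firstHit_le_hitPeriod (w : List ℤ) (d : ℕ) : firstHit w d ≤ hitPeriod w := by
  rw [firstHit]
  split_ifs with h
  · exact h
  · exact Nat.zero_le _

theorem hits_firstHit {w : List ℤ} {d : ℕ} (h : firstHit w d ≠ 0) : Hits w d (firstHit w d) := by
  rw [firstHit] at h ⊢
  split_ifs at h ⊢ with hlt
  · have hlt' : (List.range (hitPeriod w)).findIdx (fun i => decide (Hits w d (i + 1))) <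
        (List.range (hitPeriod w)).length := by rwa [List.length_range]
    have hget := List.findIdx_getElem (w := hlt')
    rw [List.getElem_range] at hget
    exact of_decide_eq_true hget
  · exact absurd rfl h

theorem firstHit_le {w : List ℤ} {d j : ℕ} (hw : 0 < w.length) (hj : 0 < j) (h : Hits w d j) :
    0 < firstHit w d ∧ firstHit w d ≤ j := by
  have hM : 0 < hitPeriod w := by
    rw [hitPeriod]
    omega
  -- Reduce `j` modulo the period, to the range `1, …, hitPeriod w`.
  obtain ⟨i, hiM, hij, hi⟩ : ∃ i, i < hitPeriod w ∧ i + 1 ≤ j ∧ Hits w d (i + 1) := by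
    have hmod : ((j - 1) % hitPeriod w + 1) ≡ j [MOD hitPeriod w] := by
      have h1 := (Nat.mod_modEq (j - 1) (hitPeriod w)).add_right 1
      rwa [Nat.sub_add_cancel hj] at h1
    refine ⟨(j - 1) % hitPeriod w, Nat.mod_lt _ hM, ?_, ?_⟩
    · have := Nat.mod_le (j - 1) (hitPeriod w)
      omega
    · refine (hits_congr ?_ (hmod.mul_right d)).2 h
      exact Nat.ModEq.of_dvd ((by norm_num : 2 ∣ 4).mul_right _ : 2 ∣ hitPeriod w) hmod
  have hidx : (List.range (hitPeriod w)).findIdx (fun i => decide (Hits w d (i + 1))) ≤ i := by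
    by_contra! hlt
    have hfalse := List.not_of_lt_findIdx hlt
    rw [List.getElem_range] at hfalse
    exact of_decide_eq_false hfalse hi
  rw [firstHit, if_pos (hidx.trans_lt hiM)]
  omega

theorem length_initialWord_pos {T : ℕ} (s : ℕ → ℤ) (hT : 1 ≤ T) :
    0 < (initialWord s T).length := by
  rwa [initialWord, List.length_map, List.length_range]

section Sequences

variable {T : ℕ} {s : ℕ → ℤ}

theorem periodicLetter_initialWord (hT : 1 ≤ T) (hper : ∀ n, 1 ≤ n → s (n + T) = s n) (i : ℕ) :
    periodicLetter (initialWord s T) i = s (i + 1) := by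
  have hlen : (initialWord s T).length = T := by simp [initialWord]
  have hmod : ∀ q r, s (r + T * q + 1) = s (r + 1) := by
    intro q r
    induction q with
    | zero => rfl
    | succ q ih =>
      rw [← ih, show r + T * (q + 1) + 1 = r + T * q + 1 + T by ring]
      exact hper _ (by omega)
  have hlt : i % T < T := Nat.mod_lt _ hT
  rw [periodicLetter, hlen, List.getD_eq_getElem _ _ (by rwa [hlen])]
  simp only [initialWord, List.getElem_map, List.getElem_range]
  conv_rhs => rw [← Nat.mod_add_div i T]
  exact (hmod _ _).symm

theorem letterMatches_initialWord (hT : 1 ≤ T) (hper : ∀ n, 1 ≤ n → s (n + T) = s n)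
    {j n e k : ℕ} (hk : 1 ≤ k) (hkn : k + 2 = n + e) :
    LetterMatches (initialWord s T) j n e ↔ s k = -(-1) ^ (j + n / 2) * fibOffset e := by
  have hlen : (initialWord s T).length = T := by simp [initialWord]
  have hletter : periodicLetter (initialWord s T) (n + e + 3 * (T - 1)) = s k := by
    have harg : n + e + 3 * (T - 1) = k - 1 + T * 3 := by omega
    have : periodicLetter (initialWord s T) (n + e + 3 * (T - 1)) =
        periodicLetter (initialWord s T) (k - 1) := by
      rw [periodicLetter, periodicLetter, hlen, harg, Nat.add_mul_mod_self_left]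
    rw [this, periodicLetter_initialWord hT hper, Nat.sub_add_cancel hk]
  rw [LetterMatches, hlen, hletter, requiredSign_eq]

theorem hits_of_accounts (hT : 1 ≤ T) (hper : ∀ n, 1 ≤ n → s (n + T) = s n) {d j e k : ℕ}
    (hk : 1 ≤ k) (h : Accounts (s k) d j e k) : Hits (initialWord s T) d j := by
  obtain ⟨he, h2, hkd, hs⟩ := h
  have hm := (letterMatches_initialWord hT hper hk hkd).2 hs
  refine ⟨Nat.mod_eq_zero_of_dvd h2, ?_⟩
  rcases he with rfl | rfl | rfl | rfl <;> simp [hm]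

theorem exists_accounts_of_hits (hT : 1 ≤ T) (hper : ∀ n, 1 ≤ n → s (n + T) = s n) {d j : ℕ}
    (hdj : 3 ≤ j * d) (h : Hits (initialWord s T) d j) :
    ∃ e k, k + 2 = j * d + e ∧ e ≤ 4 ∧ Accounts (s k) d j e k := by
  obtain ⟨h2, hm⟩ := h
  have h2' := Nat.dvd_of_mod_eq_zero h2
  have key : ∀ e, (e = 0 ∨ e = 1 ∨ e = 3 ∨ e = 4) →
      LetterMatches (initialWord s T) j (j * d) e →
      ∃ e k, k + 2 = j * d + e ∧ e ≤ 4 ∧ Accounts (s k) d j e k := fun e he hm => by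
    refine ⟨e, j * d + e - 2, by omega, by omega, he, h2', by omega, ?_⟩
    exact (letterMatches_initialWord hT hper (by omega) (by omega)).1 hm
  rcases hm with hm | hm | hm | hm
  exacts [key 0 (by simp) hm, key 1 (by simp) hm, key 3 (by simp) hm, key 4 (by simp) hm]

theorem accountedSet_upper (hT : 1 ≤ T) (hper : ∀ n, 1 ≤ n → s (n + T) = s n) {n d : ℕ}
    (hd : d ∈ accountedSet s n) :
    d ∈ Finset.Ioc 0 ((n + 2) / firstHit (initialWord s T) d) := by
  have hd0 := (Finset.mem_Ioc.1 (accountedSet_subset s n hd)).1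
  obtain ⟨k, h3, hkn, j, e, hj, hacc⟩ := mem_accountedSet_iff.1 hd
  have hlen := length_initialWord_pos s hT
  obtain ⟨hx, hxj⟩ := firstHit_le hlen hj (hits_of_accounts hT hper (by omega) hacc)
  rw [Finset.mem_Ioc, Nat.le_div_iff_mul_le hx]
  refine ⟨hd0, ?_⟩
  obtain ⟨_, _, hk, _⟩ := hacc
  have := Nat.mul_le_mul_right d hxj
  rw [mul_comm]
  omega

/-- The integers `d ≤ 4` are left out because the multiple given by the first hit may be too small to
account for a term of index at least `3`. -/
theorem accountedSet_lower (hT : 1 ≤ T) (hper : ∀ n, 1 ≤ n → s (n + T) = s n) {n d : ℕ}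
    (hd4 : 4 < d) (hd : d ≤ (n - 2) / firstHit (initialWord s T) d) :
    d ∈ accountedSet s n := by
  have hx : firstHit (initialWord s T) d ≠ 0 := by
    intro h0
    rw [h0, Nat.div_zero] at hd
    omega
  rw [Nat.le_div_iff_mul_le (Nat.pos_of_ne_zero hx), mul_comm] at hd
  have hdx := Nat.le_mul_of_pos_left d (Nat.pos_of_ne_zero hx)
  obtain ⟨e, k, hk, he, hacc⟩ := exists_accounts_of_hits hT hper (by omega) (hits_firstHit hx)
  exact mem_accountedSet_iff.2 ⟨k, by omega, by omega, _, e, Nat.pos_of_ne_zero hx, hacc⟩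

/-- For `d = 1` one of the multiples `2` and `4` accounts for the term of index `3`: the signs they
require of it are opposite. -/
theorem firstHit_one_pos (hT : 1 ≤ T) (hs : ∀ n, 1 ≤ n → s n = -1 ∨ s n = 1)
    (hper : ∀ n, 1 ≤ n → s (n + T) = s n) : 0 < firstHit (initialWord s T) 1 := by
  have hlen := length_initialWord_pos s hT
  rcases hs 3 (by norm_num) with h3 | h3
  · refine (firstHit_le hlen (j := 4) (by norm_num) ?_).1
    exact hits_of_accounts hT hper (k := 3) (e := 1) (by norm_num)
      ⟨by simp, by norm_num, by norm_num, by rw [h3]; norm_num [fibOffset]⟩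
  · refine (firstHit_le hlen (j := 2) (by norm_num) ?_).1
    exact hits_of_accounts hT hper (k := 3) (e := 3) (by norm_num)
      ⟨by simp, by norm_num, by norm_num, by rw [h3]; norm_num [fibOffset]⟩

end Sequences

/-! ### The constant and the density of the accounted integers -/

/-- The numerator of the constant attached to the word `w`. -/
def constantNum (w : List ℤ) : ℕ :=
  ∑ r ∈ Finset.range (hitPeriod w),
    classWeight (hitPeriod w) r * ((hitPeriod w).factorial / firstHit w r) ^ 2

/-- The denominator of the constant attached to the word `w`. The maximum with `1` matters for the
empty word only. -/
def constantDen (w : List ℤ) : ℕ :=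
  max 1 (∑ r ∈ Finset.range (hitPeriod w), classWeight (hitPeriod w) r) *
    (hitPeriod w).factorial ^ 2

/-- The constant attached to the word `w`: the mean value of `1 / firstHit w r ^ 2` over the
residue classes `r`, with the weights `classWeight`. A class without a hit counts as `0`, which is
the value of both `1 / 0` and the natural number quotient `n / 0`. -/
def wordConstant (w : List ℤ) : ℚ := (constantNum w : ℚ) / (constantDen w : ℚ)

theorem constantDen_ne_zero (w : List ℤ) : constantDen w ≠ 0 := by
  refine Nat.mul_ne_zero ?_ (pow_ne_zero _ (Nat.factorial_ne_zero _))
  omega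

theorem wordConstant_eq_sum {w : List ℤ} (hw : 0 < w.length) :
    (wordConstant w : ℝ) = ∑ r ∈ Finset.range (hitPeriod w), (classWeight (hitPeriod w) r : ℝ) /
      (∑ i ∈ Finset.range (hitPeriod w), classWeight (hitPeriod w) i : ℕ) *
        (1 / (firstHit w r : ℝ)) ^ 2 := by
  have hM : 0 < hitPeriod w := by
    rw [hitPeriod]
    omega
  set H := ∑ i ∈ Finset.range (hitPeriod w), classWeight (hitPeriod w) i with hH
  have hH0 : 0 < H := Finset.sum_pos (fun i _ => classWeight_pos hM i) ⟨0, Finset.mem_range.2 hM⟩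
  have hH0' : (H : ℝ) ≠ 0 := by exact_mod_cast hH0.ne'
  have hfac : ((hitPeriod w).factorial : ℝ) ≠ 0 := by exact_mod_cast Nat.factorial_ne_zero _
  rw [wordConstant, constantNum, constantDen, ← hH, max_eq_right hH0]
  push_cast
  rw [Finset.sum_div]
  refine Finset.sum_congr rfl fun r _ => ?_
  rcases Nat.eq_zero_or_pos (firstHit w r) with h0 | h0
  · simp [h0]
  · have hdvd : firstHit w r ∣ (hitPeriod w).factorial :=
      Nat.dvd_factorial h0 (firstHit_le_hitPeriod w r)
    have h0' : (firstHit w r : ℝ) ≠ 0 := by exact_mod_cast h0.ne'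
    rw [Nat.cast_div hdvd h0']
    field_simp

theorem wordConstant_pos {w : List ℤ} (hw : 0 < w.length) (h1 : 0 < firstHit w 1) :
    0 < wordConstant w := by
  have hM : 1 < hitPeriod w := by
    rw [hitPeriod]
    omega
  have hnum : 0 < constantNum w := by
    refine Finset.sum_pos' (fun _ _ => Nat.zero_le _) ⟨1, Finset.mem_range.2 hM, ?_⟩
    refine Nat.mul_pos (classWeight_pos (by omega) 1) (pow_pos (Nat.div_pos ?_ h1) 2)
    exact Nat.le_of_dvd (Nat.factorial_pos _)
      (Nat.dvd_factorial h1 (firstHit_le_hitPeriod w 1))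
  have hden := Nat.pos_of_ne_zero (constantDen_ne_zero w)
  rw [wordConstant]
  positivity

theorem tendsto_sum_totient_mod_comp {M r : ℕ} (hr : r < M) {x : ℕ} {y : ℕ → ℕ}
    (hy : Tendsto (fun n : ℕ => ((y n : ℕ) : ℝ) / n) atTop (nhds (1 / x)))
    (hy0 : x = 0 → ∀ n, y n = 0) :
    Tendsto (fun n : ℕ => (∑ d ∈ Finset.Ioc 0 (y n) with d % M = r, (d.totient : ℝ)) /
      (n : ℝ) ^ 2) atTop (nhds (3 / Real.pi ^ 2 * (classWeight M r /
        (∑ i ∈ Finset.range M, classWeight M i : ℕ)) * (1 / (x : ℝ)) ^ 2)) := by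
  rcases Nat.eq_zero_or_pos x with h0 | h0
  · simp [hy0 h0, h0]
  · have hx : (0 : ℝ) < 1 / x := by positivity
    have htop : Tendsto y atTop atTop := by
      have h := hy.pos_mul_atTop hx (tendsto_natCast_atTop_atTop (R := ℝ))
      refine tendsto_natCast_atTop_iff.1 (h.congr' ?_)
      filter_upwards [eventually_ge_atTop 1] with n hn
      have hn0 : (n : ℝ) ≠ 0 := by positivity
      exact div_mul_cancel₀ _ hn0
    have h := ((tendsto_sum_totient_mod hr).comp htop).mul (hy.pow 2)
    refine h.congr' ?_
    filter_upwards [eventually_ge_atTop 1, htop.eventually_ge_atTop 1] with n hn hyn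
    have hn0 : (n : ℝ) ≠ 0 := by positivity
    have hyn0 : (y n : ℝ) ≠ 0 := by positivity
    simp only [Function.comp]
    field_simp

theorem tendsto_add_two_div_div {x : ℕ} :
    Tendsto (fun n : ℕ => (((n + 2) / x : ℕ) : ℝ) / n) atTop (nhds (1 / x)) := by
  rcases Nat.eq_zero_or_pos x with rfl | hx
  · simp
  have h1 := (tendsto_nat_div_div hx.ne').comp (tendsto_add_atTop_nat 2)
  have h2 := (tendsto_natCast_div_add_atTop (2 : ℝ)).inv₀ one_ne_zero
  have h := h1.mul h2
  rw [inv_one, mul_one] at h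
  refine h.congr' ?_
  filter_upwards [eventually_ge_atTop 1] with n hn
  have hn0 : (n : ℝ) ≠ 0 := by positivity
  have hn2 : (n : ℝ) + 2 ≠ 0 := by positivity
  simp only [Function.comp]
  push_cast
  field_simp

theorem tendsto_sub_two_div_div {x : ℕ} :
    Tendsto (fun n : ℕ => (((n - 2) / x : ℕ) : ℝ) / n) atTop (nhds (1 / x)) := by
  rcases Nat.eq_zero_or_pos x with rfl | hx
  · simp
  rw [← tendsto_add_atTop_iff_nat 2]
  have h := (tendsto_nat_div_div hx.ne').mul (tendsto_natCast_div_add_atTop (2 : ℝ))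
  rw [mul_one] at h
  refine h.congr' ?_
  filter_upwards [eventually_ge_atTop 1] with n hn
  have hn0 : (n : ℝ) ≠ 0 := by positivity
  have hn2 : (n : ℝ) + 2 ≠ 0 := by positivity
  rw [Nat.add_sub_cancel]
  push_cast
  field_simp

/-- In the residue class `r`, membership of `d` in `accountedSet s n` means `d * x ≤ n` up to a
bounded error, where `x` is the first hit of the class. -/
theorem tendsto_sum_accountedSet {T : ℕ} {s : ℕ → ℤ} (hT : 1 ≤ T)
    (hper : ∀ n, 1 ≤ n → s (n + T) = s n) :
    Tendsto (fun n : ℕ => (∑ d ∈ accountedSet s n, (d.totient : ℝ)) / (n : ℝ) ^ 2) atTop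
      (nhds (3 / Real.pi ^ 2 * wordConstant (initialWord s T))) := by
  set w := initialWord s T with hw
  have hlen : 0 < w.length := length_initialWord_pos s hT
  have hM : 0 < hitPeriod w := by
    rw [hitPeriod]
    omega
  rw [wordConstant_eq_sum hlen, Finset.mul_sum]
  have hsplit : ∀ n : ℕ, (∑ d ∈ accountedSet s n, (d.totient : ℝ)) / (n : ℝ) ^ 2 =
      ∑ r ∈ Finset.range (hitPeriod w),
        (∑ d ∈ accountedSet s n with d % hitPeriod w = r, (d.totient : ℝ)) / (n : ℝ) ^ 2 := by
    intro n
    rw [← Finset.sum_div]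
    congr 1
    exact (Finset.sum_fiberwise_of_maps_to
      (fun d _ => Finset.mem_range.2 (Nat.mod_lt d hM)) _).symm
  simp_rw [hsplit]
  refine tendsto_finsetSum _ fun r hr => ?_
  rw [Finset.mem_range] at hr
  rw [← mul_assoc]
  have hup := tendsto_sum_totient_mod_comp hr (x := firstHit w r)
    (y := fun n => (n + 2) / firstHit w r) tendsto_add_two_div_div
    (fun h n => by rw [h, Nat.div_zero])
  have hlow := tendsto_sum_totient_mod_comp hr (x := firstHit w r)
    (y := fun n => (n - 2) / firstHit w r) tendsto_sub_two_div_div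
    (fun h n => by rw [h, Nat.div_zero])
  have hconst : Tendsto (fun n : ℕ => (∑ d ∈ Finset.Ioc 0 4, (d.totient : ℝ)) / (n : ℝ) ^ 2)
      atTop (nhds 0) :=
    tendsto_const_nhds.div_atTop
      ((tendsto_pow_atTop two_ne_zero).comp tendsto_natCast_atTop_atTop)
  have hlow' := hlow.sub hconst
  rw [sub_zero] at hlow'
  have hfirst : ∀ d, d % hitPeriod w = r → firstHit w d = firstHit w r := fun d hd => by
    rw [← hd, firstHit_mod]
  refine tendsto_of_tendsto_of_tendsto_of_le_of_le hlow' hup (fun n => ?_) (fun n => ?_)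
  · simp only
    rw [← sub_div]
    refine div_le_div_of_nonneg_right ?_ (by positivity)
    rw [sub_le_iff_le_add, ← Finset.sum_union_inter]
    refine le_add_of_le_of_nonneg (Finset.sum_le_sum_of_subset_of_nonneg ?_
      fun _ _ _ => Nat.cast_nonneg _) (Finset.sum_nonneg fun _ _ => Nat.cast_nonneg _)
    intro d hd
    rw [Finset.mem_filter, Finset.mem_Ioc] at hd
    rw [Finset.mem_union, Finset.mem_filter, Finset.mem_Ioc]
    by_cases h4 : d ≤ 4
    · exact Or.inr ⟨hd.1.1, h4⟩
    · refine Or.inl ⟨accountedSet_lower hT hper (not_le.1 h4) ?_, hd.2⟩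
      rw [← hw, hfirst d hd.2]
      exact hd.1.2
  · simp only
    refine div_le_div_of_nonneg_right ?_ (by positivity)
    refine Finset.sum_le_sum_of_subset_of_nonneg ?_ fun _ _ _ => Nat.cast_nonneg _
    intro d hd
    rw [Finset.mem_filter] at hd ⊢
    refine ⟨?_, hd.2⟩
    have h := accountedSet_upper hT hper hd.1
    rwa [← hw, hfirst d hd.2] at h

/-! ### Computability of the constant -/

section Computability

variable {α : Type*} [Primcodable α]

theorem Primrec.sum_range {f : α → ℕ → ℕ} {g : α → ℕ} (hf : Primrec₂ f) (hg : Primrec g) :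
    Primrec fun a => ∑ i ∈ Finset.range (g a), f a i := by
  refine (Primrec.nat_rec' (h := fun a p => p.2 + f a p.1) hg (Primrec.const 0) ?_).of_eq ?_
  · exact Primrec.nat_add.comp (Primrec.snd.comp Primrec.snd)
      (hf.comp Primrec.fst (Primrec.fst.comp Primrec.snd))
  · intro a
    induction g a with
    | zero => simp
    | succ n ih => simp only [Finset.sum_range_succ, ← ih]

theorem Primrec.factorial : Primrec Nat.factorial := by
  refine (Primrec.nat_rec₁ (f := fun n m => (n + 1) * m) 1 ?_).of_eq ?_
  · exact Primrec.nat_mul.comp (Primrec.succ.comp Primrec.fst) Primrec.snd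
  · intro n
    induction n with
    | zero => rfl
    | succ n ih => rw [Nat.factorial_succ, ← ih]

theorem Primrec.nat_pow_two : Primrec fun n : ℕ => n ^ 2 :=
  (Primrec.nat_mul.comp Primrec.id Primrec.id).of_eq fun n => (sq n).symm

theorem Primrec.nat_dvd : PrimrecRel ((· ∣ ·) : ℕ → ℕ → Prop) :=
  (Primrec.eq.comp (Primrec.nat_mod.comp Primrec.snd Primrec.fst) (Primrec.const 0)).of_eq
    fun _ => Nat.dvd_iff_mod_eq_zero.symm

theorem Primrec.nat_gcd : Primrec₂ Nat.gcd := by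
  have hrel : PrimrecRel fun (p : ℕ × ℕ) c => c ∣ p.1 ∧ c ∣ p.2 :=
    (Primrec.nat_dvd.comp Primrec.snd (Primrec.fst.comp Primrec.fst)).and
      (Primrec.nat_dvd.comp Primrec.snd (Primrec.snd.comp Primrec.fst))
  refine (Primrec.nat_findGreatest (f := fun p : ℕ × ℕ => p.1 + p.2)
    (Primrec.nat_add.comp Primrec.fst Primrec.snd) hrel).of_eq ?_
  rintro ⟨a, b⟩
  rw [Nat.findGreatest_eq_iff]
  refine ⟨?_, fun _ => ⟨Nat.gcd_dvd_left a b, Nat.gcd_dvd_right a b⟩, ?_⟩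
  · rcases Nat.eq_zero_or_pos a with h | h
    · simp [h]
    · exact (Nat.gcd_le_left b h).trans (Nat.le_add_right a b)
  · rintro n hlt hle ⟨ha, hb⟩
    have hpos : 0 < Nat.gcd a b := by
      rcases Nat.eq_zero_or_pos (Nat.gcd a b) with h0 | h0
      · rw [Nat.gcd_eq_zero_iff] at h0
        simp only [h0.1, h0.2] at hle hlt
        omega
      · exact h0
    exact absurd (Nat.le_of_dvd hpos (Nat.dvd_gcd ha hb)) (not_le.2 hlt)

theorem Primrec.totient : Primrec Nat.totient := by
  have hcop : PrimrecRel fun n i : ℕ => n.gcd i = 1 :=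
    Primrec.eq.comp (Primrec.nat_gcd.comp Primrec.fst Primrec.snd) (Primrec.const 1)
  have hite : Primrec₂ fun n i : ℕ => if n.gcd i = 1 then 1 else 0 :=
    Primrec.ite hcop (Primrec.const 1) (Primrec.const 0)
  refine (Primrec.sum_range hite Primrec.id).of_eq fun n => ?_
  rw [Nat.totient, Finset.card_filter]
  rfl

theorem Primrec.int_natCast : Primrec (Nat.cast : ℕ → ℤ) := by
  -- The code of the nonnegative integer `n` is `2 * n`.
  have h : Primrec fun n : ℕ => Encodable.encode (n : ℤ) := Primrec.nat_double
  exact Primrec.encode_iff.1 h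

theorem primrec_classWeight : Primrec₂ classWeight := by
  have hg : Primrec₂ fun M r : ℕ => r.gcd M := Primrec.nat_gcd.comp Primrec.snd Primrec.fst
  exact Primrec.nat_mul.comp (Primrec.totient.comp hg) (Primrec.nat_div.comp Primrec.fst hg)

theorem primrec_hitPeriod : Primrec hitPeriod :=
  Primrec.nat_mul.comp (Primrec.const 4) Primrec.list_length

theorem primrec_periodicLetter : Primrec₂ periodicLetter :=
  (Primrec.list_getD (0 : ℤ)).comp Primrec.fst
    (Primrec.nat_mod.comp Primrec.snd (Primrec.list_length.comp Primrec.fst))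

theorem primrec_requiredSign (e : ℕ) : Primrec fun n => requiredSign n e :=
  Primrec.ite (Primrec.eq.comp (Primrec.nat_mod.comp (Primrec.nat_add.comp Primrec.id
    (Primrec.const _)) (Primrec.const 2)) (Primrec.const 0)) (Primrec.const _) (Primrec.const _)

theorem primrec_letterMatches (e : ℕ) {w : α → List ℤ} {j n : α → ℕ} (hw : Primrec w)
    (hj : Primrec j) (hn : Primrec n) : PrimrecPred fun a => LetterMatches (w a) (j a) (n a) e := by
  refine Primrec.eq.comp (primrec_periodicLetter.comp hw ?_) ((primrec_requiredSign e).comp ?_)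
  · exact Primrec.nat_add.comp (Primrec.nat_add.comp hn (Primrec.const e))
      (Primrec.nat_mul.comp (Primrec.const 3)
        (Primrec.nat_sub.comp (Primrec.list_length.comp hw) (Primrec.const 1)))
  · exact Primrec.nat_add.comp hj (Primrec.nat_div.comp hn (Primrec.const 2))

theorem primrec_hits {w : α → List ℤ} {d j : α → ℕ} (hw : Primrec w) (hd : Primrec d)
    (hj : Primrec j) : PrimrecPred fun a => Hits (w a) (d a) (j a) := by
  have hn : Primrec fun a => j a * d a := Primrec.nat_mul.comp hj hd
  exact (Primrec.eq.comp (Primrec.nat_mod.comp hn (Primrec.const 2)) (Primrec.const 0)).and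
    ((primrec_letterMatches 0 hw hj hn).or ((primrec_letterMatches 1 hw hj hn).or
      ((primrec_letterMatches 3 hw hj hn).or (primrec_letterMatches 4 hw hj hn))))

theorem primrec_firstHit : Primrec₂ firstHit := by
  have hM : Primrec fun p : List ℤ × ℕ => hitPeriod p.1 := primrec_hitPeriod.comp Primrec.fst
  have hp : Primrec₂ fun (p : List ℤ × ℕ) (i : ℕ) => decide (Hits p.1 p.2 (i + 1)) :=
    (primrec_hits (Primrec.fst.comp Primrec.fst) (Primrec.snd.comp Primrec.fst)
      (Primrec.succ.comp Primrec.snd)).decide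
  have hidx : Primrec fun p : List ℤ × ℕ =>
      (List.range (hitPeriod p.1)).findIdx fun i => decide (Hits p.1 p.2 (i + 1)) :=
    Primrec.list_findIdx (Primrec.list_range.comp hM) hp
  exact Primrec.ite (Primrec.nat_lt.comp hidx hM) (Primrec.succ.comp hidx) (Primrec.const 0)

theorem primrec_constantNum : Primrec constantNum := by
  have hM : Primrec fun p : List ℤ × ℕ => hitPeriod p.1 := primrec_hitPeriod.comp Primrec.fst
  refine Primrec.sum_range ?_ primrec_hitPeriod
  exact Primrec.nat_mul.comp (primrec_classWeight.comp hM Primrec.snd)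
    (Primrec.nat_pow_two.comp (Primrec.nat_div.comp (Primrec.factorial.comp hM) primrec_firstHit))

theorem primrec_constantDen : Primrec constantDen := by
  have hM : Primrec fun p : List ℤ × ℕ => hitPeriod p.1 := primrec_hitPeriod.comp Primrec.fst
  exact Primrec.nat_mul.comp (Primrec.nat_max.comp (Primrec.const 1)
    (Primrec.sum_range (primrec_classWeight.comp hM Primrec.snd) primrec_hitPeriod))
    (Primrec.nat_pow_two.comp (Primrec.factorial.comp primrec_hitPeriod))

theorem effectivelyComputable_wordConstant : EffectivelyComputable wordConstant :=
  ⟨fun w => (constantNum w : ℤ), constantDen,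
    (Primrec.int_natCast.comp primrec_constantNum).to_comp, primrec_constantDen.to_comp,
    fun w => ⟨constantDen_ne_zero w, by rw [Int.cast_natCast, wordConstant]⟩⟩

end Computability

/-! ### Asymptotics of the least common multiple -/

theorem theorem1 :
    ∃ C : List ℤ → ℚ, EffectivelyComputable C ∧
      ∀ (T : ℕ) (s : ℕ → ℤ), 1 ≤ T →
        (∀ n, 1 ≤ n → s n = -1 ∨ s n = 1) →
        (∀ n, 1 ≤ n → s (n + T) = s n) →
        0 < C (initialWord s T) ∧
        (fun n : ℕ => Real.log (shiftedFibLcm s n : ℝ)) ~[atTop]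
          (fun n : ℕ => 3 * Real.log Real.goldenRatio / Real.pi ^ 2 *
            (C (initialWord s T) : ℝ) * (n : ℝ) ^ 2) := by
  refine ⟨wordConstant, effectivelyComputable_wordConstant, fun T s hT hs hper => ?_⟩
  have hlen := length_initialWord_pos s hT
  have hC : 0 < wordConstant (initialWord s T) :=
    wordConstant_pos hlen (firstHit_one_pos hT hs hper)
  refine ⟨hC, ?_⟩
  have hC' : (0 : ℝ) < wordConstant (initialWord s T) := by exact_mod_cast hC
  have ha : 0 < Real.log Real.goldenRatio := Real.log_pos Real.one_lt_goldenRatio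
  have hpi := Real.pi_pos
  set c : ℝ := 3 * Real.log Real.goldenRatio / Real.pi ^ 2 * wordConstant (initialWord s T) with hc
  have hc0 : c ≠ 0 := by positivity
  have hlim : Tendsto (fun n : ℕ => Real.log (shiftedFibLcm s n) / (n : ℝ) ^ 2) atTop (nhds c) := by
    have h := (tendsto_log_lcm_sub_sum_totient hs).add
      ((tendsto_sum_accountedSet hT hper).const_mul (Real.log Real.goldenRatio))
    have hval : 0 + Real.log Real.goldenRatio *
        (3 / Real.pi ^ 2 * (wordConstant (initialWord s T) : ℝ)) = c := by
      rw [hc]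
      ring
    rw [hval] at h
    refine h.congr fun n => ?_
    rw [sub_div]
    ring
  rw [isEquivalent_iff_tendsto_one]
  · have h := hlim.div_const c
    rw [div_self hc0] at h
    refine h.congr fun n => ?_
    rw [Pi.div_apply, div_div, mul_comm ((n : ℝ) ^ 2) c]
  · filter_upwards [eventually_ge_atTop 1] with n hn
    have hn0 : (n : ℝ) ≠ 0 := by positivity
    positivity
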